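/- Let $(M,\langle\cdot,\cdot\rangle)$ be a smooth $n$-dimensional Riemannian manifold with Levi-Civita connection $\nabla$, where $\nabla$ also denotes the induced connection on $1$-forms. For a smooth vector field $X$ and a smooth $1$-form $\alpha$ put $\operatorname{div}X=\operatorname{trace}(v\mapsto\nabla_vX)$ and $\operatorname{div}\alpha=\operatorname{trace}(v\mapsto(\nabla_v\alpha)^\sharp)$, let $d^*=-\operatorname{div}$ be the codifferential on $1$-forms, $\Delta f=\operatorname{div}(df)=-d^*df$ the Laplace--Beltrami operator on functions, and $\square\alpha=\operatorname{trace}\nabla^2\alpha$ the connection Laplacian on $1$-forms. Let $Z$ be a smooth vector field on $M$. Put $Zf=df(Z)$ and $Z^*f=-Zf-(\operatorname{div}Z)f$ for functions $f$. Let $$\operatorname{Ric}_Z(X,Y)=\operatorname{Ric}(X,Y)-\langle\nabla_XZ,Y\rangle ,$$ regarded as the endomorphism $\operatorname{Ric}_Z(\alpha)=\operatorname{Ric}_Z(\cdot,\alpha^\sharp)$ of $T^*M$, and let $\operatorname{Ric}_Z^*$ be its fibrewise adjoint with respect to the metric. Then: (1) for every smooth function $f$ on $M$, $$d\big((\Delta+Z)f\big)=\big(\square-\operatorname{Ric}_Z+\nabla_Z\big)(df);$$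 (2) for every smooth $1$-form $\alpha$ on $M$, $$(\Delta+Z^*)\,d^*\alpha=d^*\big((\square-\operatorname{Ric}_Z^*+\nabla_Z^*)\alpha\big),\qquad\text{where}\quad \nabla_Z^*\alpha=-\nabla_Z\alpha-(\operatorname{div}Z)\,\alpha .$$ Here all functions and forms to which $d$ or $d^*$ is applied are smooth, and $\nabla_Z^*$ is the formal adjoint of $\nabla_Z$ on $1$-forms: for all smooth $1$-forms $\alpha,\beta$, $$\langle\nabla_Z\alpha,\beta\rangle-\langle\alpha,\nabla_Z^*\beta\rangle=\operatorname{div}\big(\langle\alpha,\beta\rangle Z\big).$$ -/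

import Mathlib

open Bundle Manifold FiberBundle
open scoped ContDiff Topology InnerProductSpace

set_option linter.unusedSectionVars false

noncomputable section

namespace RiemannianGeometry

variable {E : Type*} [NormedAddCommGroup E] [NormedSpace ℝ E] [FiniteDimensional ℝ E]
  {H : Type*} [TopologicalSpace H] (I : ModelWithCorners ℝ E H)
  {M : Type*} [TopologicalSpace M] [ChartedSpace H M] [IsManifold I ∞ M]
  [RiemannianBundle (fun x : M ↦ TangentSpace I x)]

instance finiteDimensional_tangentSpace (x : M) : FiniteDimensional ℝ (TangentSpace I x) :=
  inferInstanceAs (FiniteDimensional ℝ E)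

instance completeSpace_tangentSpace (x : M) : CompleteSpace (TangentSpace I x) :=
  FiniteDimensional.complete ℝ (TangentSpace I x)

/-- An orthonormal basis `e₁, …, eₙ` of `T_x M`. -/
abbrev onb (x : M) :
    OrthonormalBasis (Fin (Module.finrank ℝ (TangentSpace I x))) ℝ (TangentSpace I x) :=
  stdOrthonormalBasis ℝ (TangentSpace I x)

/-- A vector field, smooth near `x`, whose value at `x` is the `i`-th vector of `onb I x`. -/
abbrev onbField (x : M) (i : Fin (Module.finrank ℝ (TangentSpace I x))) :
    Π y : M, TangentSpace I y :=
  extend E (onb I x i)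

/-- The right-hand side of the Koszul formula:
`½ (X⟨Y,W⟩ + Y⟨X,W⟩ - W⟨X,Y⟩ + ⟨[X,Y],W⟩ - ⟨[X,W],Y⟩ - ⟨[Y,W],X⟩)`. -/
def koszul (X Y W : Π y : M, TangentSpace I y) (x : M) : ℝ :=
  (1 / 2) * (mvfderiv I (fun y ↦ ⟪Y y, W y⟫_ℝ) x (X x)
    + mvfderiv I (fun y ↦ ⟪X y, W y⟫_ℝ) x (Y x)
    - mvfderiv I (fun y ↦ ⟪X y, Y y⟫_ℝ) x (W x)
    + ⟪VectorField.mlieBracket I X Y x, W x⟫_ℝ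
    - ⟪VectorField.mlieBracket I X W x, Y x⟫_ℝ
    - ⟪VectorField.mlieBracket I Y W x, X x⟫_ℝ)

/-- `v ↦ ∇_v Y`, where `⟨∇_{e_i} Y, e_j⟩` given by the Koszul formula. -/
def leviCivitaFun (Y : Π y : M, TangentSpace I y) (x : M) :
    TangentSpace I x →L[ℝ] TangentSpace I x :=
  ∑ i, ∑ j, (innerSL ℝ (onb I x i)).smulRight
    (koszul I (onbField I x i) Y (onbField I x j) x • onb I x j)

section
variable {I}

lemma inner_leviCivitaFun (Y : Π y : M, TangentSpace I y) (x : M) (i j) :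
    ⟪leviCivitaFun I Y x (onb I x i), onb I x j⟫_ℝ
      = koszul I (onbField I x i) Y (onbField I x j) x := by
  classical
  simp [leviCivitaFun, sum_inner, inner_smul_left, OrthonormalBasis.inner_eq_ite]

lemma ext_onb {x : M} {A B : TangentSpace I x →L[ℝ] TangentSpace I x}
    (h : ∀ i j, ⟪A (onb I x i), onb I x j⟫_ℝ = ⟪B (onb I x i), onb I x j⟫_ℝ) : A = B := by
  apply ContinuousLinearMap.coe_injective
  refine (onb I x).toBasis.ext fun i ↦ ?_
  refine InnerProductSpace.ext_inner_right_basis (𝕜 := ℝ) (onb I x).toBasis fun j ↦ ?_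
  simpa using h i j

lemma mdifferentiableAt_onbField (x : M) (i) : MDiffAt (T% (onbField I x i)) x :=
  mdifferentiableAt_extend ..

variable [IsContMDiffRiemannianBundle I ∞ E (fun x : M ↦ TangentSpace I x)]

lemma mdifferentiableAt_inner {X Y : Π y : M, TangentSpace I y} {x : M}
    (hX : MDiffAt (T% X) x) (hY : MDiffAt (T% Y) x) :
    MDifferentiableAt I 𝓘(ℝ) (fun y ↦ ⟪X y, Y y⟫_ℝ) x :=
  MDifferentiableAt.inner_bundle (IB := I) (F := E) (E := fun x : M ↦ TangentSpace I x)
    (b := fun y ↦ y) (v := X) (w := Y) hX hY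

lemma koszul_add {X Y Y' W : Π y : M, TangentSpace I y} {x : M}
    (hX : MDiffAt (T% X) x) (hY : MDiffAt (T% Y) x) (hY' : MDiffAt (T% Y') x)
    (hW : MDiffAt (T% W) x) :
    koszul I X (Y + Y') W x = koszul I X Y W x + koszul I X Y' W x := by
  simp only [koszul, Pi.add_apply, inner_add_left, inner_add_right, map_add,
    VectorField.mlieBracket_add_right hY hY', VectorField.mlieBracket_add_left hY hY']
  rw [mvfderiv_fun_add (mdifferentiableAt_inner hY hW) (mdifferentiableAt_inner hY' hW),
    mvfderiv_fun_add (mdifferentiableAt_inner hX hY) (mdifferentiableAt_inner hX hY')]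
  simp only [add_apply]
  ring

lemma koszul_smul {X Y W : Π y : M, TangentSpace I y} {f : M → ℝ} {x : M}
    (hX : MDiffAt (T% X) x) (hY : MDiffAt (T% Y) x) (hW : MDiffAt (T% W) x) (hf : MDiffAt f x) :
    koszul I X (f • Y) W x = f x * koszul I X Y W x + mvfderiv I f x (X x) * ⟪Y x, W x⟫_ℝ := by
  simp only [koszul, Pi.smul_apply', inner_smul_left, inner_smul_right, map_smul,
    VectorField.mlieBracket_smul_right hf hY, VectorField.mlieBracket_smul_left hf hY,
    inner_add_left]
  simp only [RCLike.conj_to_real]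
  rw [mvfderiv_fun_mul hf (mdifferentiableAt_inner hY hW),
    mvfderiv_fun_mul hf (mdifferentiableAt_inner hX hY)]
  simp only [add_apply, smul_apply, smul_eq_mul,
    real_inner_comm (X x) (Y x)]
  ring

end

/-- The Levi-Civita connection `∇`; `leviCivita I Y x v` is `∇_v Y`. -/
def leviCivita [IsContMDiffRiemannianBundle I ∞ E (fun x : M ↦ TangentSpace I x)] :
    CovariantDerivative I E (fun x : M ↦ TangentSpace I x) where
  toFun := leviCivitaFun I
  isCovariantDerivativeOnUniv :=
    { add := by
        intro Y Y' x h h' _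
        refine ext_onb fun i j ↦ ?_
        rw [add_apply, inner_add_left]
        simp only [inner_leviCivitaFun]
        exact koszul_add (mdifferentiableAt_onbField x i) h h' (mdifferentiableAt_onbField x j)
      leibniz := by
        intro Y f x h hf _
        refine ext_onb fun i j ↦ ?_
        rw [add_apply, inner_add_left, smul_apply,
          inner_smul_left]
        simp only [inner_leviCivitaFun]
        rw [koszul_smul (mdifferentiableAt_onbField x i) h (mdifferentiableAt_onbField x j) hf]
        simp [inner_smul_left] }

section
variable {I} [IsContMDiffRiemannianBundle I ∞ E (fun x : M ↦ TangentSpace I x)]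

/-- `∇` is torsion-free. -/
theorem leviCivita_torsion :
    (leviCivita I : CovariantDerivative I E (fun x : M ↦ TangentSpace I x)).torsion = 0 := by
  funext x
  apply ContinuousLinearMap.coe_injective
  refine (onb I x).toBasis.ext fun i ↦ ?_
  apply ContinuousLinearMap.coe_injective
  refine (onb I x).toBasis.ext fun j ↦ ?_
  refine InnerProductSpace.ext_inner_right_basis (𝕜 := ℝ) (onb I x).toBasis fun k ↦ ?_
  simp only [ContinuousLinearMap.coe_coe, OrthonormalBasis.coe_toBasis,
    CovariantDerivative.torsion_apply_eq_extend, extend_apply_self, inner_sub_left]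
  change ⟪leviCivitaFun I (onbField I x j) x (onb I x i), onb I x k⟫_ℝ
    - ⟪leviCivitaFun I (onbField I x i) x (onb I x j), onb I x k⟫_ℝ - _ = ⟪0, _⟫_ℝ
  rw [inner_leviCivitaFun, inner_leviCivitaFun, inner_zero_left]
  simp only [koszul, real_inner_comm]
  rw [VectorField.mlieBracket_swap_apply (V := onbField I x j) (W := onbField I x i)]
  simp only [extend_apply_self, inner_neg_right]
  ring_nf

/-- `∇` is a metric connection. -/
theorem leviCivita_isMetricCompatible :
    CovariantDerivative.IsMetricCompatible (F := E) (V := fun x : M ↦ TangentSpace I x)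
    (leviCivita I : CovariantDerivative I E (fun x : M ↦ TangentSpace I x)) := by
  funext x
  apply ContinuousLinearMap.coe_injective
  refine (onb I x).toBasis.ext fun i ↦ ?_
  apply ContinuousLinearMap.coe_injective
  refine (onb I x).toBasis.ext fun j ↦ ?_
  apply ContinuousLinearMap.coe_injective
  refine (onb I x).toBasis.ext fun k ↦ ?_
  simp only [ContinuousLinearMap.coe_coe, OrthonormalBasis.coe_toBasis,
    CovariantDerivative.derivMetricTensor_apply_eq_extend]
  change _ - ⟪leviCivitaFun I (onbField I x i) x (onb I x k), onb I x j⟫_ℝ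
    - ⟪_, leviCivitaFun I (onbField I x j) x (onb I x k)⟫_ℝ = 0
  rw [real_inner_comm _ (onb I x i), inner_leviCivitaFun, inner_leviCivitaFun]
  simp only [koszul, real_inner_comm]
  rw [VectorField.mlieBracket_swap_apply (V := onbField I x j) (W := onbField I x i)]
  simp only [extend_apply_self, inner_neg_right]
  ring_nf
end

/-- Smoothness of a vector field. -/
def IsSmoothField (Z : Π x : M, TangentSpace I x) : Prop :=
  ContMDiff I I.tangent ∞ (fun x ↦ (⟨x, Z x⟩ : TangentBundle I M))

/-- Smoothness of a `1`-form. -/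
def IsSmoothForm (α : Π x : M, TangentSpace I x →L[ℝ] ℝ) : Prop :=
  ContMDiff I (I.prod 𝓘(ℝ, E →L[ℝ] ℝ)) ∞
    (fun x ↦ TotalSpace.mk' (E →L[ℝ] ℝ) (E := fun x : M ↦ TangentSpace I x →L[ℝ] ℝ) x (α x))

/-- The musical isomorphism `v ↦ v♭ = ⟨v, ·⟩` from `T_x M` to `T_x^* M`; its inverse is `♯`. -/
def flat (x : M) : TangentSpace I x ≃L[ℝ] (TangentSpace I x →L[ℝ] ℝ) :=
  LinearEquiv.toContinuousLinearEquiv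
    { (InnerProductSpace.toDual ℝ (TangentSpace I x)).toLinearEquiv.toAddEquiv with
      map_smul' := fun c v ↦ by simp }

/-- The inner product of `T_x^* M` which makes `♭` an isometry. -/
def formInner (x : M) (a b : TangentSpace I x →L[ℝ] ℝ) : ℝ :=
  ⟪(flat I x).symm a, (flat I x).symm b⟫_ℝ

/-- The adjoint of an endomorphism of `T_x^* M` with respect to `formInner`. -/
def formAdjoint (x : M)
    (A : (TangentSpace I x →L[ℝ] ℝ) →L[ℝ] (TangentSpace I x →L[ℝ] ℝ)) :
    (TangentSpace I x →L[ℝ] ℝ) →L[ℝ] (TangentSpace I x →L[ℝ] ℝ) :=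
  (flat I x : TangentSpace I x →L[ℝ] (TangentSpace I x →L[ℝ] ℝ)) ∘L
    ContinuousLinearMap.adjoint
      (((flat I x).symm : (TangentSpace I x →L[ℝ] ℝ) →L[ℝ] TangentSpace I x) ∘L A ∘L
        (flat I x : TangentSpace I x →L[ℝ] (TangentSpace I x →L[ℝ] ℝ))) ∘L
    ((flat I x).symm : (TangentSpace I x →L[ℝ] ℝ) →L[ℝ] TangentSpace I x)

variable [IsContMDiffRiemannianBundle I ∞ E (fun x : M ↦ TangentSpace I x)]

/-- The covariant derivative of a `1`-form induced by `∇`: `covForm I α x v` is `∇_v α`, determined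
by `(∇_v α)(W) = v(α(W)) - α(∇_v W)`, where `W` runs through the fields extending a basis of
`T_x M`. -/
def covForm (α : Π x : M, TangentSpace I x →L[ℝ] ℝ) (x : M) :
    TangentSpace I x →L[ℝ] (TangentSpace I x →L[ℝ] ℝ) :=
  ∑ j, (mvfderiv I (fun y ↦ α y (onbField I x j y)) x
    - α x ∘L leviCivita I (onbField I x j) x).smulRight (flat I x (onb I x j))

/-- The second covariant derivative `∇²α (u, v) = ∇_u (∇_V α) - ∇_{∇_u V} α` of a `1`-form,
where `V` is a vector field extending `v`. -/
def covForm₂ (α : Π x : M, TangentSpace I x →L[ℝ] ℝ) (x : M) (u v : TangentSpace I x) :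
    TangentSpace I x →L[ℝ] ℝ :=
  covForm I (fun y ↦ covForm I α y (extend E v y)) x u
    - covForm I α x (leviCivita I (extend E v) x u)

/-- The connection Laplacian `□α = trace ∇²α` of a `1`-form. -/
def boxForm (α : Π x : M, TangentSpace I x →L[ℝ] ℝ) (x : M) : TangentSpace I x →L[ℝ] ℝ :=
  ∑ i, covForm₂ I α x (onb I x i) (onb I x i)

/-- The divergence `trace (v ↦ ∇_v Z)` of a vector field. -/
def divField (Z : Π x : M, TangentSpace I x) (x : M) : ℝ :=
  LinearMap.trace ℝ (TangentSpace I x)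
    (leviCivita I Z x : TangentSpace I x →ₗ[ℝ] TangentSpace I x)

/-- The divergence `trace (v ↦ (∇_v α)♯)` of a `1`-form. -/
def divForm (α : Π x : M, TangentSpace I x →L[ℝ] ℝ) (x : M) : ℝ :=
  LinearMap.trace ℝ (TangentSpace I x)
    ((((flat I x).symm : (TangentSpace I x →L[ℝ] ℝ) →L[ℝ] TangentSpace I x) ∘L covForm I α x :
      TangentSpace I x →L[ℝ] TangentSpace I x) : TangentSpace I x →ₗ[ℝ] TangentSpace I x)

/-- The codifferential `d^* = -div` on `1`-forms. -/
def codiff (α : Π x : M, TangentSpace I x →L[ℝ] ℝ) (x : M) : ℝ :=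
  -divForm I α x

/-- The Laplace-Beltrami operator `Δf = div (df)` on functions. -/
def laplacian (f : M → ℝ) (x : M) : ℝ :=
  divForm I (mvfderiv I f) x

/-- The derivative `Zf = df(Z)` of a function along a vector field. -/
def fieldDeriv (Z : Π x : M, TangentSpace I x) (f : M → ℝ) (x : M) : ℝ :=
  mvfderiv I f x (Z x)

/-- `Z^* f = -Zf - (div Z) f`. -/
def fieldDerivAdjoint (Z : Π x : M, TangentSpace I x) (f : M → ℝ) (x : M) : ℝ :=
  -fieldDeriv I Z f x - divField I Z x * f x

/-- `∇_Z α`. -/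
def covAlong (Z : Π x : M, TangentSpace I x) (α : Π x : M, TangentSpace I x →L[ℝ] ℝ) (x : M) :
    TangentSpace I x →L[ℝ] ℝ :=
  covForm I α x (Z x)

/-- `∇_Z^* α = -∇_Z α - (div Z) α`. -/
def covAlongAdjoint (Z : Π x : M, TangentSpace I x) (α : Π x : M, TangentSpace I x →L[ℝ] ℝ)
    (x : M) : TangentSpace I x →L[ℝ] ℝ :=
  -covAlong I Z α x - divField I Z x • α x

/-- The curvature `R(U,V)W = ∇_U ∇_V W - ∇_V ∇_U W - ∇_{[U,V]} W`. -/
def curvature (U V W : Π x : M, TangentSpace I x) (x : M) : TangentSpace I x :=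
  leviCivita I (fun y ↦ leviCivita I W y (V y)) x (U x)
    - leviCivita I (fun y ↦ leviCivita I W y (U y)) x (V x)
    - leviCivita I W x (VectorField.mlieBracket I U V x)

/-- The Ricci tensor, the bilinear form on `T_x M` whose components in an orthonormal basis are
`Ric(e_j, e_k) = ∑ i, ⟨R(e_i, e_j) e_k, e_i⟩`. -/
def ricci (x : M) : TangentSpace I x →L[ℝ] TangentSpace I x →L[ℝ] ℝ :=
  ∑ j, ∑ k, (flat I x (onb I x j)).smulRight
    ((∑ i, ⟪curvature I (onbField I x i) (onbField I x j) (onbField I x k) x, onb I x i⟫_ℝ) •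
      flat I x (onb I x k))

/-- `Ric_Z(X, Y) = Ric(X, Y) - ⟨∇_X Z, Y⟩`. -/
def ricciZ (Z : Π x : M, TangentSpace I x) (x : M) :
    TangentSpace I x →L[ℝ] TangentSpace I x →L[ℝ] ℝ :=
  ricci I x - (flat I x : TangentSpace I x →L[ℝ] (TangentSpace I x →L[ℝ] ℝ)) ∘L leviCivita I Z x

/-- `Ric_Z` as an endomorphism of `T_x^* M`: `Ric_Z(α) = Ric_Z(·, α♯)`. -/
def ricciZForm (Z : Π x : M, TangentSpace I x) (x : M) :
    (TangentSpace I x →L[ℝ] ℝ) →L[ℝ] (TangentSpace I x →L[ℝ] ℝ) :=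
  (ricciZ I Z x).flip ∘L ((flat I x).symm : (TangentSpace I x →L[ℝ] ℝ) →L[ℝ] TangentSpace I x)

end RiemannianGeometry

end

open Bundle Manifold FiberBundle
open scoped ContDiff Topology InnerProductSpace

set_option linter.unusedSectionVars false

noncomputable section

namespace RiemannianGeometry

variable {E : Type*} [NormedAddCommGroup E] [NormedSpace ℝ E] [FiniteDimensional ℝ E]
  {H : Type*} [TopologicalSpace H] {I : ModelWithCorners ℝ E H}
  {M : Type*} [TopologicalSpace M] [ChartedSpace H M] [IsManifold I ∞ M]

/-! ### Smooth functions and smooth vector fields -/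

lemma contMDiff_fieldDeriv' {U : Π x : M, TangentSpace I x} {f : M → ℝ}
    (hU : ContMDiff I I.tangent ∞ (fun x ↦ (⟨x, U x⟩ : TangentBundle I M)))
    (hf : ContMDiff I 𝓘(ℝ) ∞ f) :
    ContMDiff I 𝓘(ℝ) ∞ (fun y ↦ mvfderiv I f y (U y)) :=
  (contMDiff_snd_tangentBundle_modelSpace ℝ 𝓘(ℝ) (n := ∞)).comp
    ((hf.contMDiff_tangentMap (m := ∞) (by simp)).comp hU)

variable [RiemannianBundle (fun x : M ↦ TangentSpace I x)]

lemma IsSmoothField.contMDiff {X : Π x : M, TangentSpace I x} (hX : IsSmoothField I X) :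
    CMDiff ∞ (T% X) := hX

lemma IsSmoothField.mdiff {X : Π x : M, TangentSpace I x} (hX : IsSmoothField I X) (x : M) :
    MDiffAt (T% X) x := (hX x).mdifferentiableAt (by simp)

lemma contMDiff_fieldDeriv {U : Π x : M, TangentSpace I x} {f : M → ℝ}
    (hU : IsSmoothField I U) (hf : ContMDiff I 𝓘(ℝ) ∞ f) :
    ContMDiff I 𝓘(ℝ) ∞ (fieldDeriv I U f) := contMDiff_fieldDeriv' hU hf

lemma IsSmoothField.add {X Y : Π x : M, TangentSpace I x} (hX : IsSmoothField I X)
    (hY : IsSmoothField I Y) : IsSmoothField I (X + Y) :=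
  ContMDiff.add_section hX.contMDiff hY.contMDiff

lemma IsSmoothField.sub {X Y : Π x : M, TangentSpace I x} (hX : IsSmoothField I X)
    (hY : IsSmoothField I Y) : IsSmoothField I (X - Y) :=
  ContMDiff.sub_section hX.contMDiff hY.contMDiff

lemma IsSmoothField.smul {X : Π x : M, TangentSpace I x} {f : M → ℝ} (hX : IsSmoothField I X)
    (hf : ContMDiff I 𝓘(ℝ) ∞ f) : IsSmoothField I (f • X) :=
  ContMDiff.smul_section hf hX.contMDiff

lemma IsSmoothField.sum {ι : Type*} {s : Finset ι} {X : ι → Π x : M, TangentSpace I x}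
    (hX : ∀ i ∈ s, IsSmoothField I (X i)) : IsSmoothField I (fun x ↦ ∑ i ∈ s, X i x) :=
  ContMDiff.sum_section (t := X) hX

lemma IsSmoothField.bracket {X Y : Π x : M, TangentSpace I x} (hX : IsSmoothField I X)
    (hY : IsSmoothField I Y) : IsSmoothField I (VectorField.mlieBracket I X Y) := fun x ↦ by
  have : IsManifold I ((⊤ : ℕ∞) + 1) M := inferInstanceAs (IsManifold I ∞ M)
  have : IsManifold I (minSmoothness ℝ 2) M := by
    rw [minSmoothness_of_isRCLikeNormedField]; infer_instance
  exact ContMDiffAt.mlieBracket_vectorField (n := ⊤) (m := ⊤) (hX x) (hY x) (by simp)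

lemma IsSmoothField.congr_at {X : Π x : M, TangentSpace I x}
    (h : ∀ x, ∃ Y, IsSmoothField I Y ∧ ∀ᶠ y in 𝓝 x, X y = Y y) : IsSmoothField I X := fun x ↦ by
  obtain ⟨Y, hY, hXY⟩ := h x
  refine (hY x).congr_of_eventuallyEq ?_
  filter_upwards [hXY] with y hy
  rw [hy]

section T2
variable [T2Space M]

/-- A vector field which is smooth near `x` agrees near `x` with a globally smooth one. -/
lemma exists_smoothField_eventuallyEq {X : Π x : M, TangentSpace I x} {x : M} {u : Set M}
    (hu : u ∈ 𝓝 x) (hX : CMDiff[u] ∞ (T% X)) :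
    ∃ Y, IsSmoothField I Y ∧ ∀ᶠ y in 𝓝 x, Y y = X y := by
  obtain ⟨ψ, -, hψ⟩ := (SmoothBumpFunction.nhds_basis_tsupport (I := I) x).mem_iff.1
    (interior_mem_nhds.2 hu)
  refine ⟨(ψ : M → ℝ) • X, ContMDiffOn.smul_section_of_tsupport ψ.contMDiff.contMDiffOn
    isOpen_interior hψ (hX.mono interior_subset), ?_⟩
  filter_upwards [ψ.eventuallyEq_one] with y hy
  simp [hy]

end T2

variable [IsContMDiffRiemannianBundle I ∞ E (fun x : M ↦ TangentSpace I x)]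

lemma IsSmoothField.inner {X Y : Π x : M, TangentSpace I x} (hX : IsSmoothField I X)
    (hY : IsSmoothField I Y) : ContMDiff I 𝓘(ℝ) ∞ (fun y ↦ ⟪X y, Y y⟫_ℝ) :=
  ContMDiff.inner_bundle (IB := I) (F := E) (E := fun x : M ↦ TangentSpace I x)
    (b := fun y ↦ y) (v := X) (w := Y) hX hY

/-! ### Smooth local orthonormal frames -/

/-- A family of globally smooth vector fields which is orthonormal near `x`. -/
structure IsOrthonormalFrameNear (e : Fin (Module.finrank ℝ E) → Π y : M, TangentSpace I y)
    (x : M) : Prop where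
  smooth : ∀ i, IsSmoothField I (e i)
  orthonormal : ∀ᶠ y in 𝓝 x, Orthonormal ℝ (fun i ↦ e i y)

lemma contMDiffOn_inner {X Y : Π y : M, TangentSpace I y} {u : Set M}
    (hX : CMDiff[u] ∞ (T% X)) (hY : CMDiff[u] ∞ (T% Y)) :
    ContMDiffOn I 𝓘(ℝ) ∞ (fun y ↦ ⟪X y, Y y⟫_ℝ) u :=
  ContMDiffOn.inner_bundle (IB := I) (F := E) (E := fun x : M ↦ TangentSpace I x)
    (b := fun y ↦ y) (v := X) (w := Y) hX hY

lemma contMDiffOn_gramSchmidt {m : ℕ} {b : Fin m → Π y : M, TangentSpace I y}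
    (hb : ∀ i, IsSmoothField I (b i)) {u : Set M}
    (hu : ∀ y ∈ u, LinearIndependent ℝ (fun i ↦ b i y)) (i : Fin m) :
    CMDiff[u] ∞ (T% (fun y ↦ InnerProductSpace.gramSchmidt ℝ (fun j ↦ b j y) i)) := by
  induction i using WellFoundedLT.induction with
  | ind i ih =>
    have hdef (y : M) : InnerProductSpace.gramSchmidt ℝ (fun j ↦ b j y) i = b i y -
        ∑ j ∈ Finset.Iio i, (⟪InnerProductSpace.gramSchmidt ℝ (fun j ↦ b j y) j, b i y⟫_ℝ /
          ((‖InnerProductSpace.gramSchmidt ℝ (fun j ↦ b j y) j‖ ^ 2 : ℝ))) •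
            InnerProductSpace.gramSchmidt ℝ (fun j ↦ b j y) j := by
      rw [InnerProductSpace.gramSchmidt_def]
      simp [Submodule.starProjection_singleton]
    simp only [hdef]
    refine ContMDiffOn.sub_section (s := b i) (t := fun y ↦ ∑ j ∈ Finset.Iio i, _)
      (hb i).contMDiff.contMDiffOn ?_
    refine ContMDiffOn.sum_section (t := fun j y ↦ _) fun j hj ↦ ?_
    have hj' := ih j (Finset.mem_Iio.1 hj)
    refine ContMDiffOn.smul_section (f := fun y ↦ _ / _) (s := fun y ↦ _) ?_ hj'
    refine ContMDiffOn.div₀ ?_ ?_ ?_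
    · exact contMDiffOn_inner hj' (hb i).contMDiff.contMDiffOn
    · simp only [← real_inner_self_eq_norm_sq]
      exact contMDiffOn_inner hj' hj'
    · intro y hy
      have := InnerProductSpace.gramSchmidt_ne_zero (𝕜 := ℝ) j (hu y hy)
      simpa using this

lemma contMDiffOn_gramSchmidtNormed {m : ℕ} {b : Fin m → Π y : M, TangentSpace I y}
    (hb : ∀ i, IsSmoothField I (b i)) {u : Set M}
    (hu : ∀ y ∈ u, LinearIndependent ℝ (fun i ↦ b i y)) (i : Fin m) :
    CMDiff[u] ∞ (T% (fun y ↦ InnerProductSpace.gramSchmidtNormed ℝ (fun j ↦ b j y) i)) := by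
  have h := contMDiffOn_gramSchmidt hb hu i
  have hne : ∀ y ∈ u, InnerProductSpace.gramSchmidt ℝ (fun j ↦ b j y) i ≠ 0 := fun y hy ↦
    InnerProductSpace.gramSchmidt_ne_zero (𝕜 := ℝ) i (hu y hy)
  refine ContMDiffOn.smul_section (f := fun y ↦ _) (s := fun y ↦ _) ?_ h
  refine ContMDiffOn.inv₀ ?_ fun y hy ↦ by simpa using hne y hy
  simp only [RCLike.ofReal_real_eq_id, id, norm_eq_sqrt_real_inner]
  intro y hy
  refine ContDiffAt.comp_contMDiffWithinAt (g := Real.sqrt) (Real.contDiffAt_sqrt ?_) ?_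
  · simpa using hne y hy
  · exact contMDiffOn_inner h h y hy

lemma exists_orthonormalFrame [T2Space M] (x : M) :
    ∃ e : Fin (Module.finrank ℝ E) → Π y : M, TangentSpace I y, IsOrthonormalFrameNear e x := by
  let t := trivializationAt E (fun x : M ↦ TangentSpace I x) x
  let b := Module.finBasis ℝ E
  have ht : t.baseSet ∈ 𝓝 x := t.open_baseSet.mem_nhds (mem_baseSet_trivializationAt' x)
  have hs := t.isLocalFrameOn_localFrame_baseSet I ∞ b
  choose c hc hcs using fun i ↦ exists_smoothField_eventuallyEq ht (hs.contMDiffOn i)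
  obtain ⟨u, hu, huo, hxu⟩ : ∃ u, (∀ y ∈ u, LinearIndependent ℝ (fun i ↦ c i y)) ∧
      IsOpen u ∧ x ∈ u := by
    apply eventually_nhds_iff.1
    filter_upwards [Filter.eventually_all.2 hcs, ht] with y hy hyt
    simp only [hy]
    exact hs.linearIndependent hyt
  choose e he hes using fun i ↦ exists_smoothField_eventuallyEq (huo.mem_nhds hxu)
    (contMDiffOn_gramSchmidtNormed hc hu i)
  refine ⟨e, he, ?_⟩
  filter_upwards [Filter.eventually_all.2 hes, huo.mem_nhds hxu] with y hy hyu
  simp only [hy]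
  exact InnerProductSpace.gramSchmidtNormed_orthonormal (hu y hyu)

section pointwise
variable {x : M} {e : Fin (Module.finrank ℝ E) → TangentSpace I x}

/-- The orthonormal basis of `T_x M` given by an orthonormal family of `dim E` vectors. -/
def basisOfOrthonormal (he : Orthonormal ℝ e) :
    OrthonormalBasis (Fin (Module.finrank ℝ E)) ℝ (TangentSpace I x) :=
  OrthonormalBasis.mk he (he.linearIndependent.span_eq_top_of_card_eq_finrank'
    (Fintype.card_fin _)).ge

@[simp] lemma basisOfOrthonormal_apply (he : Orthonormal ℝ e) (i) :
    basisOfOrthonormal he i = e i := by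
  simp [basisOfOrthonormal]

lemma sum_inner_smul (he : Orthonormal ℝ e) (v : TangentSpace I x) :
    ∑ i, ⟪e i, v⟫_ℝ • e i = v := by
  simpa using (basisOfOrthonormal he).sum_repr' v

lemma trace_eq_sum_inner' (he : Orthonormal ℝ e)
    (A : TangentSpace I x →L[ℝ] TangentSpace I x) :
    LinearMap.trace ℝ (TangentSpace I x) (A : TangentSpace I x →ₗ[ℝ] TangentSpace I x)
      = ∑ i, ⟪A (e i), e i⟫_ℝ := by
  rw [LinearMap.trace_eq_sum_inner _ (basisOfOrthonormal he)]
  simp [real_inner_comm]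

lemma ext_of_orthonormal (he : Orthonormal ℝ e) {v w : TangentSpace I x}
    (h : ∀ i, ⟪e i, v⟫_ℝ = ⟪e i, w⟫_ℝ) : v = w := by
  rw [← sum_inner_smul he v, ← sum_inner_smul he w]
  simp [h]

end pointwise

/-! ### The Levi-Civita connection on smooth fields -/

/-- The vector field `∇_U A`. -/
def nabla (U A : Π y : M, TangentSpace I y) (y : M) : TangentSpace I y :=
  leviCivita I A y (U y)

section
variable {U V W A B : Π y : M, TangentSpace I y} {f : M → ℝ} {x : M}

lemma nabla_sub_nabla (hU : MDiffAt (T% U) x) (hV : MDiffAt (T% V) x) :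
    nabla U V x - nabla V U x = VectorField.mlieBracket I U V x :=
  (CovariantDerivative.torsion_eq_zero_iff _).1 leviCivita_torsion hU hV

lemma mvfderiv_inner (hA : MDiffAt (T% A) x) (hB : MDiffAt (T% B) x) (v : TangentSpace I x) :
    mvfderiv I (fun y ↦ ⟪A y, B y⟫_ℝ) x v
      = ⟪leviCivita I A x v, B x⟫_ℝ + ⟪A x, leviCivita I B x v⟫_ℝ := by
  have := leviCivita_isMetricCompatible.mvfderiv_inner_eq (extend E v) hA hB
  simpa using this

lemma fieldDeriv_inner (hA : MDiffAt (T% A) x) (hB : MDiffAt (T% B) x) :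
    fieldDeriv I U (fun y ↦ ⟪A y, B y⟫_ℝ) x
      = ⟪nabla U A x, B x⟫_ℝ + ⟪A x, nabla U B x⟫_ℝ := mvfderiv_inner hA hB _

lemma inner_nabla (hU : MDiffAt (T% U) x) (hA : MDiffAt (T% A) x) (hW : MDiffAt (T% W) x) :
    ⟪nabla U A x, W x⟫_ℝ = koszul I U A W x := by
  have h1 := fieldDeriv_inner (U := U) hA hW
  have h2 := fieldDeriv_inner (U := A) hU hW
  have h3 := fieldDeriv_inner (U := W) hU hA
  simp only [fieldDeriv] at h1 h2 h3
  rw [koszul, h1, h2, h3, ← nabla_sub_nabla hU hA, ← nabla_sub_nabla hU hW,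
    ← nabla_sub_nabla hA hW]
  simp only [inner_sub_left]
  rw [real_inner_comm (nabla U W x) (A x), real_inner_comm (nabla A W x) (U x),
    real_inner_comm (nabla W A x) (U x)]
  ring

lemma mvfderiv_congr {g : M → ℝ} (h : ∀ᶠ y in 𝓝 x, f y = g y) :
    mvfderiv I f x = mvfderiv I g x := by
  have : mfderiv I 𝓘(ℝ) f x = mfderiv I 𝓘(ℝ) g x := Filter.EventuallyEq.mfderiv_eq h
  ext v
  change mfderiv I 𝓘(ℝ) f x v = mfderiv I 𝓘(ℝ) g x v
  rw [this]
  rfl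

lemma fieldDeriv_congr {g : M → ℝ} (h : ∀ᶠ y in 𝓝 x, f y = g y) :
    fieldDeriv I U f x = fieldDeriv I U g x := by
  simp [fieldDeriv, mvfderiv_congr h]

lemma leviCivita_congr (h : ∀ᶠ y in 𝓝 x, A y = B y) : leviCivita I A x = leviCivita I B x := by
  refine ext_onb fun i j ↦ ?_
  change ⟪leviCivitaFun I A x _, _⟫_ℝ = ⟪leviCivitaFun I B x _, _⟫_ℝ
  rw [inner_leviCivitaFun, inner_leviCivitaFun]
  have hl (X : Π y : M, TangentSpace I y) : mvfderiv I (fun y ↦ ⟪X y, A y⟫_ℝ) x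
      = mvfderiv I (fun y ↦ ⟪X y, B y⟫_ℝ) x :=
    mvfderiv_congr (by filter_upwards [h] with y hy; rw [hy])
  have hr (X : Π y : M, TangentSpace I y) : mvfderiv I (fun y ↦ ⟪A y, X y⟫_ℝ) x
      = mvfderiv I (fun y ↦ ⟪B y, X y⟫_ℝ) x :=
    mvfderiv_congr (by filter_upwards [h] with y hy; rw [hy])
  have hbl (X : Π y : M, TangentSpace I y) : VectorField.mlieBracket I X A x
      = VectorField.mlieBracket I X B x :=
    Filter.EventuallyEq.mlieBracket_vectorField_eq (Filter.EventuallyEq.refl _ _) h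
  have hbr (X : Π y : M, TangentSpace I y) : VectorField.mlieBracket I A X x
      = VectorField.mlieBracket I B X x :=
    Filter.EventuallyEq.mlieBracket_vectorField_eq h (Filter.EventuallyEq.refl _ _)
  simp only [koszul, hl, hr, hbl, hbr, h.self_of_nhds]

lemma nabla_congr (h : ∀ᶠ y in 𝓝 x, A y = B y) : nabla U A x = nabla U B x := by
  simp [nabla, leviCivita_congr h]

lemma nabla_add_right (hA : MDiffAt (T% A) x) (hB : MDiffAt (T% B) x) :
    nabla U (A + B) x = nabla U A x + nabla U B x := by
  simp [nabla, (leviCivita I).isCovariantDerivativeOnUniv.add hA hB]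

lemma nabla_smul_right (hf : MDiffAt f x) (hA : MDiffAt (T% A) x) :
    nabla U (f • A) x = f x • nabla U A x + fieldDeriv I U f x • A x := by
  simp [nabla, (leviCivita I).isCovariantDerivativeOnUniv.leibniz hA hf, fieldDeriv]

lemma nabla_add_left : nabla (U + V) A = nabla U A + nabla V A := by
  funext y; simp [nabla]

lemma nabla_smul_left : nabla (f • U) A = f • nabla U A := by
  funext y; simp [nabla]

lemma nabla_neg_right (hA : MDiffAt (T% A) x) : nabla U (-A) x = -nabla U A x := by
  have := (leviCivita I).isCovariantDerivativeOnUniv.smul_const (-1) hA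
  simp only [neg_smul, one_smul] at this
  simp [nabla, this]

lemma nabla_sub_right (hA : MDiffAt (T% A) x) (hB : MDiffAt (T% B) x) :
    nabla U (A - B) x = nabla U A x - nabla U B x := by
  rw [sub_eq_add_neg, nabla_add_right hA (mdifferentiableAt_neg_section hB), nabla_neg_right hB,
    sub_eq_add_neg]

lemma nabla_sum_right {ι : Type*} {s : Finset ι} {A : ι → Π y : M, TangentSpace I y}
    (hA : ∀ i ∈ s, MDiffAt (T% (A i)) x) :
    nabla U (fun y ↦ ∑ i ∈ s, A i y) x = ∑ i ∈ s, nabla U (A i) x := by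
  classical
  induction s using Finset.induction_on with
  | empty =>
    have := (leviCivita I : CovariantDerivative I E (fun x : M ↦ TangentSpace I x)).zero
    simp only [Finset.sum_empty, nabla]
    change (leviCivita I : CovariantDerivative I E (fun x : M ↦ TangentSpace I x)) 0 x _ = 0
    rw [this]; rfl
  | insert a s ha h =>
    simp only [Finset.mem_insert, forall_eq_or_imp] at hA
    simp only [Finset.sum_insert ha, ← h hA.2]
    exact nabla_add_right (A := A a) (B := fun y ↦ ∑ i ∈ s, A i y) hA.1 (.sum_section hA.2)

lemma contMDiff_koszul (hU : IsSmoothField I U) (hA : IsSmoothField I A) (hW : IsSmoothField I W) :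
    ContMDiff I 𝓘(ℝ) ∞ (koszul I U A W) := by
  have h1 := contMDiff_fieldDeriv hU (hA.inner hW)
  have h2 := contMDiff_fieldDeriv hA (hU.inner hW)
  have h3 := contMDiff_fieldDeriv hW (hU.inner hA)
  have h4 := (hU.bracket hA).inner hW
  have h5 := (hU.bracket hW).inner hA
  have h6 := (hA.bracket hW).inner hU
  exact contMDiff_const.mul (((((h1.add h2).sub h3).add h4).sub h5).sub h6)

end

section T2
variable [T2Space M] {U V W A B : Π y : M, TangentSpace I y} {f : M → ℝ} {x : M}

lemma IsSmoothField.nabla (hU : IsSmoothField I U) (hA : IsSmoothField I A) :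
    IsSmoothField I (nabla U A) := by
  refine IsSmoothField.congr_at fun x ↦ ?_
  obtain ⟨e, he⟩ := exists_orthonormalFrame (I := I) x
  refine ⟨fun y ↦ ∑ i, koszul I U A (e i) y • e i y, IsSmoothField.sum fun i _ ↦
    (he.smooth i).smul (contMDiff_koszul hU hA (he.smooth i)), ?_⟩
  filter_upwards [he.orthonormal] with y hy
  rw [← sum_inner_smul hy (RiemannianGeometry.nabla U A y)]
  refine Finset.sum_congr rfl fun i _ ↦ ?_
  rw [← inner_nabla (hU.mdiff y) (hA.mdiff y) ((he.smooth i).mdiff y), real_inner_comm]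

lemma mdiff_nabla (hU : MDiffAt (T% U) x) (hA : IsSmoothField I A) :
    MDiffAt (T% (nabla U A)) x := by
  obtain ⟨e, he⟩ := exists_orthonormalFrame (I := I) x
  have h : MDiffAt (T% (fun y ↦ ∑ i, ⟪e i y, U y⟫_ℝ • nabla (e i) A y)) x := by
    refine MDifferentiableAt.sum_section (t := fun i y ↦ _) fun i _ ↦ ?_
    exact MDifferentiableAt.smul_section (mdifferentiableAt_inner ((he.smooth i).mdiff x) hU)
      (((he.smooth i).nabla hA).mdiff x)
  refine h.congr_of_eventuallyEq ?_
  filter_upwards [he.orthonormal] with y hy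
  congr 1
  conv_lhs => rw [nabla, ← sum_inner_smul hy (U y)]
  simp [nabla]

end T2

section
variable [T2Space M]

/-! ### Curvature -/

variable {U V W A B : Π y : M, TangentSpace I y} {f g : M → ℝ} {x : M}

lemma minSmoothness_two_le : minSmoothness ℝ 2 ≤ ∞ := by
  rw [minSmoothness_of_isRCLikeNormedField]
  exact ENat.LEInfty.out

lemma exists_smoothField_eventuallyEq_extend {x : M} (v : TangentSpace I x) :
    ∃ W : Π y : M, TangentSpace I y, IsSmoothField I W ∧ W x = v ∧
      ∀ᶠ y in 𝓝 x, W y = extend E v y := by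
  obtain ⟨s, hs, h⟩ := exists_contMDiffOn_extend (k := ∞) I E v
  obtain ⟨W, hW, hWv⟩ := exists_smoothField_eventuallyEq hs h
  exact ⟨W, hW, by simpa using hWv.self_of_nhds, hWv⟩

lemma ContMDiff.mdiff (hf : ContMDiff I 𝓘(ℝ) ∞ f) (x : M) : MDiffAt f x :=
  (hf x).mdifferentiableAt (by simp)

lemma fieldDeriv_add (hf : MDiffAt f x) (hg : MDiffAt g x) :
    fieldDeriv I U (f + g) x = fieldDeriv I U f x + fieldDeriv I U g x := by
  simp [fieldDeriv, mvfderiv_add hf hg]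

lemma fieldDeriv_sum {ι : Type} {s : Finset ι} {f : ι → M → ℝ}
    (hf : ∀ i ∈ s, MDiffAt (f i) x) :
    fieldDeriv I U (fun y ↦ ∑ i ∈ s, f i y) x = ∑ i ∈ s, fieldDeriv I U (f i) x := by
  classical
  induction s using Finset.induction_on with
  | empty => simp [fieldDeriv, mvfderiv_const]
  | insert a s ha h =>
    simp only [Finset.mem_insert, forall_eq_or_imp] at hf
    simp only [Finset.sum_insert ha, ← h hf.2]
    refine fieldDeriv_add (g := fun y ↦ ∑ i ∈ s, f i y) hf.1 ?_
    have : MDifferentiableAt I 𝓘(ℝ) (∑ i ∈ s, f i) x := MDifferentiableAt.sum hf.2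
    convert this using 1
    ext y; simp

lemma mlieBracket_smul_eq (hf : ContMDiff I 𝓘(ℝ) ∞ f) (hW : IsSmoothField I W) :
    VectorField.mlieBracket I V (f • W)
      = fieldDeriv I V f • W + f • VectorField.mlieBracket I V W := by
  funext y
  rw [VectorField.mlieBracket_smul_right (ContMDiff.mdiff hf y) (hW.mdiff y)]
  rfl

lemma fieldDeriv_mlieBracket (hU : IsSmoothField I U) (hV : IsSmoothField I V)
    (hf : ContMDiff I 𝓘(ℝ) ∞ f) :
    fieldDeriv I (VectorField.mlieBracket I U V) f x
      = fieldDeriv I U (fieldDeriv I V f) x - fieldDeriv I V (fieldDeriv I U f) x := by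
  by_cases hx : ∀ v : TangentSpace I x, v = 0
  · simp [fieldDeriv, hx (U x), hx (V x), hx (VectorField.mlieBracket I U V x)]
  push Not at hx
  obtain ⟨v, hv⟩ := hx
  obtain ⟨W, hW, rfl, -⟩ := exists_smoothField_eventuallyEq_extend v
  have : IsManifold I (minSmoothness ℝ 3) M := by
    rw [minSmoothness_of_isRCLikeNormedField]; infer_instance
  have jac {Y : Π y : M, TangentSpace I y} (hY : IsSmoothField I Y) :=
    VectorField.leibniz_identity_mlieBracket_apply (I := I) (U := U) (V := V) (W := Y) (x := x)
      ((hU x).of_le minSmoothness_two_le) ((hV x).of_le minSmoothness_two_le) ((hY x).of_le minSmoothness_two_le)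
  have h1 := jac hW
  have h2 := jac (hW.smul hf)
  have hUf := contMDiff_fieldDeriv hU hf
  have hVf := contMDiff_fieldDeriv hV hf
  have hUW := hU.bracket hW
  have hVW := hV.bracket hW
  rw [mlieBracket_smul_eq hf hW, mlieBracket_smul_eq hf hW, mlieBracket_smul_eq hf hW,
    VectorField.mlieBracket_add_right ((hW.smul hVf).mdiff x) ((hVW.smul hf).mdiff x),
    VectorField.mlieBracket_add_right ((hW.smul hUf).mdiff x) ((hUW.smul hf).mdiff x),
    mlieBracket_smul_eq hVf hW, mlieBracket_smul_eq hUf hW, mlieBracket_smul_eq hf hVW,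
    mlieBracket_smul_eq hf hUW] at h2
  simp only [Pi.add_apply, Pi.smul_apply', h1] at h2
  rw [← sub_eq_zero] at h2 ⊢
  refine (smul_eq_zero_iff_left hv).1 ?_
  rw [← neg_eq_zero, ← h2]
  module

lemma curvature_eq (x : M) : curvature I U V W x = nabla U (nabla V W) x - nabla V (nabla U W) x
    - leviCivita I W x (VectorField.mlieBracket I U V x) := rfl

lemma inner_curvature_self (hU : IsSmoothField I U) (hV : IsSmoothField I V)
    (hW : IsSmoothField I W) : ⟪curvature I U V W x, W x⟫_ℝ = 0 := by
  have h := fieldDeriv_mlieBracket (x := x) hU hV (hW.inner hW)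
  have hf (Y) : fieldDeriv I Y (fun y ↦ ⟪W y, W y⟫_ℝ)
      = (fun y ↦ ⟪nabla Y W y, W y⟫_ℝ) + (fun y ↦ ⟪W y, nabla Y W y⟫_ℝ) := by
    funext y; exact fieldDeriv_inner (hW.mdiff y) (hW.mdiff y)
  have hVW := hV.nabla hW
  have hUW := hU.nabla hW
  rw [hf, hf, hf, fieldDeriv_add (ContMDiff.mdiff (hVW.inner hW) x)
    (ContMDiff.mdiff (hW.inner hVW) x), fieldDeriv_add (ContMDiff.mdiff (hUW.inner hW) x)
    (ContMDiff.mdiff (hW.inner hUW) x),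
    fieldDeriv_inner (hVW.mdiff x) (hW.mdiff x), fieldDeriv_inner (hW.mdiff x) (hVW.mdiff x),
    fieldDeriv_inner (hUW.mdiff x) (hW.mdiff x), fieldDeriv_inner (hW.mdiff x) (hUW.mdiff x)] at h
  simp only [Pi.add_apply] at h
  rw [curvature_eq]
  simp only [inner_sub_left]
  change _ - ⟪nabla (VectorField.mlieBracket I U V) W x, _⟫_ℝ = 0
  rw [real_inner_comm _ (W x), real_inner_comm _ (W x), real_inner_comm _ (W x)] at h
  rw [real_inner_comm (nabla U W x) (nabla V W x)] at h
  linarith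

lemma curvature_swap : curvature I U V W x = -curvature I V U W x := by
  rw [curvature_eq, curvature_eq, VectorField.mlieBracket_swap_apply, map_neg]
  abel

lemma bianchi (hU : IsSmoothField I U) (hV : IsSmoothField I V) (hW : IsSmoothField I W) :
    curvature I U V W x + curvature I V W U x + curvature I W U V x = 0 := by
  have : IsManifold I (minSmoothness ℝ 3) M := by
    rw [minSmoothness_of_isRCLikeNormedField]; infer_instance
  have jac := VectorField.leibniz_identity_mlieBracket_apply (I := I) (U := U) (V := V) (W := W)
    (x := x) ((hU x).of_le minSmoothness_two_le) ((hV x).of_le minSmoothness_two_le) ((hW x).of_le minSmoothness_two_le)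
  have key {X Y Z : Π y : M, TangentSpace I y} (hX : IsSmoothField I X) (hY : IsSmoothField I Y)
      (hZ : IsSmoothField I Z) : nabla X (nabla Y Z) x - nabla X (nabla Z Y) x
        - leviCivita I X x (VectorField.mlieBracket I Y Z x)
        = VectorField.mlieBracket I X (VectorField.mlieBracket I Y Z) x := by
    rw [← nabla_sub_nabla (hX.mdiff x) ((hY.bracket hZ).mdiff x),
      ← nabla_sub_right ((hY.nabla hZ).mdiff x) ((hZ.nabla hY).mdiff x)]
    congr 2
    funext y
    exact nabla_sub_nabla (hY.mdiff y) (hZ.mdiff y)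
  have h1 := key hU hV hW
  have h2 := key hV hW hU
  have h3 := key hW hU hV
  have h0 : VectorField.mlieBracket I V (VectorField.mlieBracket I W U) x
      = -VectorField.mlieBracket I V (VectorField.mlieBracket I U W) x := by
    rw [VectorField.mlieBracket_swap (V := W) (W := U)]
    have := VectorField.mlieBracket_const_smul_right (I := I) (c := (-1 : ℝ)) (V := V)
      ((hU.bracket hW).mdiff x)
    simpa using this
  rw [VectorField.mlieBracket_swap_apply (V := VectorField.mlieBracket I U V), ← h3] at jac
  rw [← h1, ← neg_eq_iff_eq_neg.2 h0, ← h2] at jac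
  simp only [curvature_eq]
  rw [← sub_eq_zero] at jac
  rw [← jac]
  abel

end

section
variable [T2Space M]

variable {U V W A B : Π y : M, TangentSpace I y} {f g : M → ℝ} {x : M}

lemma curvature_congr (h : ∀ᶠ y in 𝓝 x, A y = B y) :
    curvature I U V A x = curvature I U V B x := by
  have key (X : Π y : M, TangentSpace I y) : ∀ᶠ y in 𝓝 x, nabla X A y = nabla X B y := by
    filter_upwards [h.eventually_nhds] with y hy using nabla_congr hy
  rw [curvature_eq, curvature_eq, nabla_congr (key U), nabla_congr (key V), leviCivita_congr h]

lemma tensorialAt_curvature (hW : IsSmoothField I W) (V : Π y : M, TangentSpace I y) :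
    TensorialAt I E (fun U ↦ curvature I U V W x) x where
  smul {f U} hf hU := by
    simp only [curvature_eq]
    rw [nabla_smul_left, nabla_smul_left, nabla_smul_right hf (mdiff_nabla hU hW),
      VectorField.mlieBracket_smul_left hf hU]
    simp only [map_add, map_smul, Pi.smul_apply', fieldDeriv, nabla]
    module
  add {U U'} hU hU' := by
    simp only [curvature_eq]
    rw [nabla_add_left, nabla_add_left, nabla_add_right (mdiff_nabla hU hW) (mdiff_nabla hU' hW),
      VectorField.mlieBracket_add_left hU hU']
    simp only [map_add, Pi.add_apply]
    module

lemma tensorialAt_curvature' (hW : IsSmoothField I W) (U : Π y : M, TangentSpace I y) :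
    TensorialAt I E (fun V ↦ curvature I U V W x) x where
  smul {f V} hf hV := by
    rw [curvature_swap, (tensorialAt_curvature hW U).smul hf hV, curvature_swap (U := U)]
    simp
  add {V V'} hV hV' := by
    rw [curvature_swap, (tensorialAt_curvature hW U).add hV hV', curvature_swap (U := U),
      curvature_swap (U := U)]
    abel

lemma flat_apply (u v : TangentSpace I x) : flat I x u v = ⟪u, v⟫_ℝ := rfl

/-- `R(u, v)W` as a bilinear map of `u` and `v`. -/
def curvatureHom (hW : IsSmoothField I W) (x : M) :
    TangentSpace I x →L[ℝ] TangentSpace I x →L[ℝ] TangentSpace I x :=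
  TensorialAt.mkHom₂ (fun U V ↦ curvature I U V W x) x
    (fun V _ ↦ tensorialAt_curvature hW V) (fun U _ ↦ tensorialAt_curvature' hW U)

lemma curvatureHom_apply (hW : IsSmoothField I W) (hU : MDiffAt (T% U) x)
    (hV : MDiffAt (T% V) x) : curvatureHom hW x (U x) (V x) = curvature I U V W x :=
  TensorialAt.mkHom₂_apply _ _ hU hV

lemma curvature_smul (hU : IsSmoothField I U) (hV : IsSmoothField I V) (hW : IsSmoothField I W)
    (hf : ContMDiff I 𝓘(ℝ) ∞ f) :
    curvature I U V (f • W) x = f x • curvature I U V W x := by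
  have key (X : Π y : M, TangentSpace I y) :
      nabla X (f • W) = f • nabla X W + fieldDeriv I X f • W := by
    funext y; exact nabla_smul_right (ContMDiff.mdiff hf y) (hW.mdiff y)
  have hfm := ContMDiff.mdiff hf x
  have hVf := contMDiff_fieldDeriv hV hf
  have hUf := contMDiff_fieldDeriv hU hf
  have hVW := hV.nabla hW
  have hUW := hU.nabla hW
  have h3 := fieldDeriv_mlieBracket (x := x) hU hV hf
  change _ - _ - nabla (VectorField.mlieBracket I U V) (f • W) x
    = f x • (_ - _ - nabla (VectorField.mlieBracket I U V) W x)
  change nabla U (nabla V (f • W)) x - nabla V (nabla U (f • W)) x - _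
    = f x • (nabla U (nabla V W) x - nabla V (nabla U W) x - _)
  rw [key, key, key, nabla_add_right ((hVW.smul hf).mdiff x) ((hW.smul hVf).mdiff x),
    nabla_add_right ((hUW.smul hf).mdiff x) ((hW.smul hUf).mdiff x),
    nabla_smul_right hfm (hVW.mdiff x), nabla_smul_right hfm (hUW.mdiff x),
    nabla_smul_right (ContMDiff.mdiff hVf x) (hW.mdiff x),
    nabla_smul_right (ContMDiff.mdiff hUf x) (hW.mdiff x)]
  simp only [Pi.add_apply, Pi.smul_apply', h3]
  module

lemma curvature_sum {ι : Type*} {s : Finset ι} {W : ι → Π y : M, TangentSpace I y}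
    (hU : IsSmoothField I U) (hV : IsSmoothField I V) (hW : ∀ i ∈ s, IsSmoothField I (W i)) :
    curvature I U V (fun y ↦ ∑ i ∈ s, W i y) x = ∑ i ∈ s, curvature I U V (W i) x := by
  have key (X : Π y : M, TangentSpace I y) :
      nabla X (fun y ↦ ∑ i ∈ s, W i y) = fun y ↦ ∑ i ∈ s, nabla X (W i) y := by
    funext y; exact nabla_sum_right fun i hi ↦ (hW i hi).mdiff y
  change nabla U (nabla V _) x - nabla V (nabla U _) x - nabla (VectorField.mlieBracket I U V) _ x
    = ∑ i ∈ s, (nabla U (nabla V _) x - nabla V (nabla U _) x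
      - nabla (VectorField.mlieBracket I U V) _ x)
  rw [key, key, key, nabla_sum_right fun i hi ↦ (hV.nabla (hW i hi)).mdiff x,
    nabla_sum_right fun i hi ↦ (hU.nabla (hW i hi)).mdiff x]
  simp only [Finset.sum_sub_distrib]

variable {e : Fin (Module.finrank ℝ E) → Π y : M, TangentSpace I y}

lemma curvatureHom_eq_sum (he : IsOrthonormalFrameNear e x) (hW : IsSmoothField I W)
    (u v : TangentSpace I x) :
    curvatureHom hW x u v = ∑ k, ⟪e k x, W x⟫_ℝ • curvatureHom (he.smooth k) x u v := by
  obtain ⟨U, hU, rfl, -⟩ := exists_smoothField_eventuallyEq_extend u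
  obtain ⟨V, hV, rfl, -⟩ := exists_smoothField_eventuallyEq_extend v
  simp only [curvatureHom_apply _ (hU.mdiff x) (hV.mdiff x)]
  have hf (k) := (he.smooth k).inner hW
  rw [curvature_congr (B := fun y ↦ ∑ k, ((fun y ↦ ⟪e k y, W y⟫_ℝ) • e k) y),
    curvature_sum hU hV fun k _ ↦ (he.smooth k).smul (hf k)]
  · exact Finset.sum_congr rfl fun k _ ↦ curvature_smul hU hV (he.smooth k) (hf k)
  · filter_upwards [he.orthonormal] with y hy using (sum_inner_smul hy (W y)).symm

lemma curvatureHom_eq_sum_onb {B : Fin (Module.finrank ℝ (TangentSpace I x)) →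
      Π y : M, TangentSpace I y} (hB : ∀ k, IsSmoothField I (B k)) (hBx : ∀ k, B k x = onb I x k)
    (hW : IsSmoothField I W) (u v : TangentSpace I x) :
    curvatureHom hW x u v = ∑ k, ⟪onb I x k, W x⟫_ℝ • curvatureHom (hB k) x u v := by
  obtain ⟨e, he⟩ := exists_orthonormalFrame (I := I) x
  rw [curvatureHom_eq_sum he]
  simp_rw [curvatureHom_eq_sum he (hB _), Finset.smul_sum, hBx]
  rw [Finset.sum_comm]
  refine Finset.sum_congr rfl fun k _ ↦ ?_
  simp_rw [smul_smul, ← Finset.sum_smul]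
  congr 1
  rw [← (onb I x).sum_inner_mul_inner (e k x) (W x)]
  exact Finset.sum_congr rfl fun i _ ↦ mul_comm _ _

lemma ricci_apply (hA : IsSmoothField I A) (u : TangentSpace I x) :
    ricci I x u (A x) = LinearMap.trace ℝ (TangentSpace I x)
      ((curvatureHom hA x).flip u : TangentSpace I x →ₗ[ℝ] TangentSpace I x) := by
  choose B hB hBx hBe using fun i ↦ exists_smoothField_eventuallyEq_extend (onb I x i)
  have hR (i j k) : curvature I (onbField I x i) (onbField I x j) (onbField I x k) x
      = curvatureHom (hB k) x (onb I x i) (onb I x j) := by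
    rw [curvature_congr (B := B k) (by filter_upwards [hBe k] with y hy using hy.symm),
      ← curvatureHom_apply (hB k) (mdifferentiableAt_onbField x i) (mdifferentiableAt_onbField x j)]
    simp
  have hu := (onb I x).sum_repr' u
  have hu' (w : TangentSpace I x) (k) : curvatureHom (hB k) x w u
      = ∑ j, ⟪onb I x j, u⟫_ℝ • curvatureHom (hB k) x w (onb I x j) := by
    conv_lhs => rw [← hu]
    simp
  rw [LinearMap.trace_eq_sum_inner _ (onb I x)]
  simp only [ContinuousLinearMap.coe_coe, ContinuousLinearMap.flip_apply]
  simp_rw [curvatureHom_eq_sum_onb hB hBx hA, hu', ricci, hR]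
  simp only [sum_apply, inner_sum, inner_smul_right, ContinuousLinearMap.smulRight_apply,
    smul_apply, flat_apply, smul_eq_mul, Finset.mul_sum, Finset.sum_mul]
  conv_lhs => rw [Finset.sum_comm]
  conv_rhs => rw [Finset.sum_comm]
  refine Finset.sum_congr rfl fun k _ ↦ ?_
  rw [Finset.sum_comm]
  refine Finset.sum_congr rfl fun i _ ↦ Finset.sum_congr rfl fun j _ ↦ ?_
  rw [real_inner_comm (onb I x i)]
  ring

lemma ricci_apply_frame (he : Orthonormal ℝ (fun i ↦ e i x)) (hes : ∀ i, IsSmoothField I (e i))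
    (hU : IsSmoothField I U) (hA : IsSmoothField I A) :
    ricci I x (U x) (A x) = ∑ i, ⟪curvature I (e i) U A x, e i x⟫_ℝ := by
  rw [ricci_apply hA, trace_eq_sum_inner' he]
  refine Finset.sum_congr rfl fun i _ ↦ ?_
  rw [ContinuousLinearMap.flip_apply, curvatureHom_apply hA ((hes i).mdiff x) (hU.mdiff x)]

lemma ricci_symm (hU : IsSmoothField I U) (hA : IsSmoothField I A) :
    ricci I x (U x) (A x) = ricci I x (A x) (U x) := by
  obtain ⟨e, he⟩ := exists_orthonormalFrame (I := I) x
  have ho := he.orthonormal.self_of_nhds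
  rw [ricci_apply_frame ho he.smooth hU hA, ricci_apply_frame ho he.smooth hA hU]
  refine Finset.sum_congr rfl fun i _ ↦ ?_
  have h1 := bianchi (x := x) (he.smooth i) hU hA
  have h2 := inner_curvature_self (x := x) hU hA (he.smooth i)
  have h3 := congrArg (fun v ↦ ⟪v, e i x⟫_ℝ) h1
  simp only [inner_add_left, inner_zero_left, h2] at h3
  rw [curvature_swap (U := A), inner_neg_left] at h3
  linarith

end

section
variable [T2Space M]

/-! ### The divergence of a vector field -/

variable {U V W A B Z : Π y : M, TangentSpace I y} {f g : M → ℝ} {x : M}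
  {e : Fin (Module.finrank ℝ E) → Π y : M, TangentSpace I y}

lemma divField_eq_sum (he : Orthonormal ℝ (fun i ↦ e i x)) (A : Π y : M, TangentSpace I y) :
    divField I A x = ∑ i, ⟪nabla (e i) A x, e i x⟫_ℝ := trace_eq_sum_inner' he _

lemma divField_congr (h : ∀ᶠ y in 𝓝 x, A y = B y) : divField I A x = divField I B x := by
  simp [divField, leviCivita_congr h]

lemma divField_add (hA : MDiffAt (T% A) x) (hB : MDiffAt (T% B) x) :
    divField I (A + B) x = divField I A x + divField I B x := by
  simp [divField, (leviCivita I).isCovariantDerivativeOnUniv.add hA hB]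

lemma divField_neg (hA : MDiffAt (T% A) x) : divField I (-A) x = -divField I A x := by
  have := (leviCivita I).isCovariantDerivativeOnUniv.smul_const (-1) hA
  simp only [neg_smul, one_smul] at this
  simp [divField, this]

lemma divField_sub (hA : MDiffAt (T% A) x) (hB : MDiffAt (T% B) x) :
    divField I (A - B) x = divField I A x - divField I B x := by
  rw [sub_eq_add_neg, divField_add hA (mdifferentiableAt_neg_section hB), divField_neg hB,
    sub_eq_add_neg]

lemma divField_smul (hf : MDiffAt f x) (hA : MDiffAt (T% A) x) :
    divField I (f • A) x = f x * divField I A x + fieldDeriv I A f x := by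
  obtain ⟨e, he⟩ := exists_orthonormalFrame (I := I) x
  have ho := he.orthonormal.self_of_nhds
  rw [divField_eq_sum ho, divField_eq_sum ho]
  simp only [nabla_smul_right hf hA, inner_add_left, inner_smul_left, Finset.sum_add_distrib,
    Finset.mul_sum, RCLike.conj_to_real]
  congr 1
  conv_rhs => rw [fieldDeriv, ← sum_inner_smul ho (A x)]
  simp only [map_sum, map_smul, smul_eq_mul]
  refine Finset.sum_congr rfl fun i _ ↦ ?_
  rw [real_inner_comm, mul_comm]; rfl

lemma divField_sum {ι : Type*} {s : Finset ι} {A : ι → Π y : M, TangentSpace I y}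
    (hA : ∀ i ∈ s, MDiffAt (T% (A i)) x) :
    divField I (fun y ↦ ∑ i ∈ s, A i y) x = ∑ i ∈ s, divField I (A i) x := by
  obtain ⟨e, he⟩ := exists_orthonormalFrame (I := I) x
  have ho := he.orthonormal.self_of_nhds
  simp only [divField_eq_sum ho, nabla_sum_right hA, sum_inner]
  exact Finset.sum_comm

lemma contMDiff_divField (hA : IsSmoothField I A) : ContMDiff I 𝓘(ℝ) ∞ (divField I A) := by
  intro x
  obtain ⟨e, he⟩ := exists_orthonormalFrame (I := I) x
  have h : ContMDiffAt I 𝓘(ℝ) ∞ (fun y ↦ ∑ i, ⟪nabla (e i) A y, e i y⟫_ℝ) x :=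
    contMDiffAt_finsetSum fun i _ ↦ (((he.smooth i).nabla hA).inner (he.smooth i)) x
  refine h.congr_of_eventuallyEq ?_
  filter_upwards [he.orthonormal] with y hy using divField_eq_sum hy A

lemma inner_nabla_frame (he : IsOrthonormalFrameNear e x) (i j) :
    ⟪nabla U (e i) x, e j x⟫_ℝ = -⟪e i x, nabla U (e j) x⟫_ℝ := by
  have h := fieldDeriv_inner (U := U) ((he.smooth i).mdiff x) ((he.smooth j).mdiff x)
  have h' : fieldDeriv I U (fun y ↦ ⟪e i y, e j y⟫_ℝ) x = 0 := by
    classical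
    rw [fieldDeriv_congr (g := fun _ ↦ if i = j then 1 else 0)]
    · simp [fieldDeriv, mvfderiv_const]
    · filter_upwards [he.orthonormal] with y hy using orthonormal_iff_ite.1 hy i j
  linarith

lemma sum_inner_map_skew {e w : Fin (Module.finrank ℝ E) → TangentSpace I x}
    (he : Orthonormal ℝ e) (hw : ∀ i j, ⟪w i, e j⟫_ℝ = -⟪e i, w j⟫_ℝ)
    (L : TangentSpace I x →L[ℝ] TangentSpace I x) :
    ∑ i, ⟪L (w i), e i⟫_ℝ = -∑ i, ⟪L (e i), w i⟫_ℝ := by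
  have h1 (i) : ⟪L (w i), e i⟫_ℝ = ∑ j, ⟪e j, w i⟫_ℝ * ⟪L (e j), e i⟫_ℝ := by
    conv_lhs => rw [← sum_inner_smul he (w i)]
    simp [sum_inner, inner_smul_left]
  have h2 (i) : ⟪L (e i), w i⟫_ℝ = ∑ j, ⟪e j, w i⟫_ℝ * ⟪L (e i), e j⟫_ℝ := by
    conv_lhs => rw [← sum_inner_smul he (w i)]
    simp [inner_sum, inner_smul_right]
  simp_rw [h1, h2]
  rw [Finset.sum_comm, ← Finset.sum_neg_distrib]
  refine Finset.sum_congr rfl fun i _ ↦ ?_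
  rw [← Finset.sum_neg_distrib]
  refine Finset.sum_congr rfl fun j _ ↦ ?_
  rw [real_inner_comm, hw]
  ring

/-- The trace of `∇A ∘ ∇U`. -/
def traceNablaNabla (A U : Π y : M, TangentSpace I y) (x : M) : ℝ :=
  LinearMap.trace ℝ (TangentSpace I x)
    ((leviCivita I A x ∘L leviCivita I U x : TangentSpace I x →L[ℝ] TangentSpace I x) :
      TangentSpace I x →ₗ[ℝ] TangentSpace I x)

lemma traceNablaNabla_comm : traceNablaNabla A U x = traceNablaNabla U A x := by
  simpa [traceNablaNabla] using! LinearMap.trace_mul_comm ℝ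
    (leviCivita I A x : TangentSpace I x →ₗ[ℝ] TangentSpace I x)
    (leviCivita I U x : TangentSpace I x →ₗ[ℝ] TangentSpace I x)

/-- The contracted Ricci identity. -/
theorem divField_nabla (hU : IsSmoothField I U) (hA : IsSmoothField I A) :
    divField I (nabla U A) x = fieldDeriv I U (divField I A) x + traceNablaNabla A U x
      + ricci I x (U x) (A x) := by
  obtain ⟨e, he⟩ := exists_orthonormalFrame (I := I) x
  have ho := he.orthonormal.self_of_nhds
  have hd : fieldDeriv I U (divField I A) x
      = ∑ i, (⟪nabla U (nabla (e i) A) x, e i x⟫_ℝ + ⟪nabla (e i) A x, nabla U (e i) x⟫_ℝ) := by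
    rw [fieldDeriv_congr (g := fun y ↦ ∑ i, ⟪nabla (e i) A y, e i y⟫_ℝ)
      (by filter_upwards [he.orthonormal] with y hy using divField_eq_sum hy A),
      fieldDeriv_sum fun i _ ↦ ContMDiff.mdiff (((he.smooth i).nabla hA).inner (he.smooth i)) x]
    exact Finset.sum_congr rfl fun i _ ↦ fieldDeriv_inner
      (((he.smooth i).nabla hA).mdiff x) ((he.smooth i).mdiff x)
  have hr := ricci_apply_frame ho he.smooth hU hA
  have hc (i) : curvature I (e i) U A x = nabla (e i) (nabla U A) x - nabla U (nabla (e i) A) x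
      - (leviCivita I A x (nabla (e i) U x) - leviCivita I A x (nabla U (e i) x)) := by
    rw [curvature_eq, ← nabla_sub_nabla ((he.smooth i).mdiff x) (hU.mdiff x), map_sub]
  have hs := sum_inner_map_skew ho (fun i j ↦ inner_nabla_frame (U := U) he i j)
    (leviCivita I A x)
  have ht : traceNablaNabla A U x = ∑ i, ⟪leviCivita I A x (nabla (e i) U x), e i x⟫_ℝ :=
    trace_eq_sum_inner' ho _
  simp only [hc, inner_sub_left, Finset.sum_sub_distrib] at hr
  rw [hd, hr, ht, divField_eq_sum ho, Finset.sum_add_distrib, hs]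
  change _ = _ + ∑ i, ⟪leviCivita I A x (e i x), nabla U (e i) x⟫_ℝ + _ + _
  ring

theorem divField_mlieBracket (hU : IsSmoothField I U) (hV : IsSmoothField I V) :
    divField I (VectorField.mlieBracket I U V) x
      = fieldDeriv I U (divField I V) x - fieldDeriv I V (divField I U) x := by
  have h : VectorField.mlieBracket I U V = nabla U V - nabla V U := by
    funext y; exact (nabla_sub_nabla (hU.mdiff y) (hV.mdiff y)).symm
  rw [h, divField_sub ((hU.nabla hV).mdiff x) ((hV.nabla hU).mdiff x), divField_nabla hU hV,
    divField_nabla hV hU, traceNablaNabla_comm, ricci_symm hU hV]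
  ring

/-- The divergence of the divergence of `U ∧ V` vanishes. -/
theorem divField_divField_wedge (hU : IsSmoothField I U) (hV : IsSmoothField I V) :
    divField I (divField I U • V - divField I V • U + VectorField.mlieBracket I U V) x = 0 := by
  have h1 := contMDiff_divField hU
  have h2 := contMDiff_divField hV
  rw [divField_add (((hV.smul h1).sub (hU.smul h2)).mdiff x) ((hU.bracket hV).mdiff x),
    divField_sub ((hV.smul h1).mdiff x) ((hU.smul h2).mdiff x),
    divField_smul (ContMDiff.mdiff h1 x) (hV.mdiff x),
    divField_smul (ContMDiff.mdiff h2 x) (hU.mdiff x), divField_mlieBracket hU hV]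
  ring

end

section
variable [T2Space M]

/-! ### Gradient, Ricci endomorphism and connection Laplacian on vector fields -/

variable {U V W A B Z : Π y : M, TangentSpace I y} {f g : M → ℝ} {x : M}
  {e : Fin (Module.finrank ℝ E) → Π y : M, TangentSpace I y}

lemma IsOrthonormalFrameNear.eventually (he : IsOrthonormalFrameNear e x) :
    ∀ᶠ y in 𝓝 x, IsOrthonormalFrameNear e y := by
  filter_upwards [he.orthonormal.eventually_nhds] with y hy using ⟨he.smooth, hy⟩

lemma inner_flat_symm (a : TangentSpace I x →L[ℝ] ℝ) (v : TangentSpace I x) :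
    ⟪(flat I x).symm a, v⟫_ℝ = a v := by
  rw [← flat_apply, ContinuousLinearEquiv.apply_symm_apply]

variable (I) in
/-- The vector field `α♯`. -/
def sharp (α : Π x : M, TangentSpace I x →L[ℝ] ℝ) (x : M) : TangentSpace I x :=
  (flat I x).symm (α x)

lemma inner_sharp (α : Π x : M, TangentSpace I x →L[ℝ] ℝ) (v : TangentSpace I x) :
    ⟪sharp I α x, v⟫_ℝ = α x v := inner_flat_symm _ _

lemma isSmoothField_of_inner (h : ∀ X : Π y : M, TangentSpace I y, IsSmoothField I X →
    ContMDiff I 𝓘(ℝ) ∞ (fun y ↦ ⟪A y, X y⟫_ℝ)) : IsSmoothField I A := by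
  refine IsSmoothField.congr_at fun x ↦ ?_
  obtain ⟨e, he⟩ := exists_orthonormalFrame (I := I) x
  refine ⟨fun y ↦ ∑ i, ⟪A y, e i y⟫_ℝ • e i y, IsSmoothField.sum fun i _ ↦
    (he.smooth i).smul (h _ (he.smooth i)), ?_⟩
  filter_upwards [he.orthonormal] with y hy
  conv_lhs => rw [← sum_inner_smul hy (A y)]
  simp only [real_inner_comm]

variable (I) in
/-- The gradient of a function. -/
abbrev gradField (f : M → ℝ) : Π x : M, TangentSpace I x := sharp I (mvfderiv I f)

lemma inner_gradField (f : M → ℝ) : ⟪gradField I f x, U x⟫_ℝ = fieldDeriv I U f x :=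
  inner_sharp _ _

lemma isSmoothField_gradField (hf : ContMDiff I 𝓘(ℝ) ∞ f) : IsSmoothField I (gradField I f) := by
  refine isSmoothField_of_inner fun X hX ↦ ?_
  simp_rw [inner_gradField]
  exact contMDiff_fieldDeriv hX hf

/-- The Hessian of a function is symmetric. -/
lemma inner_nabla_gradField (hf : ContMDiff I 𝓘(ℝ) ∞ f) (hU : IsSmoothField I U)
    (hV : IsSmoothField I V) :
    ⟪nabla U (gradField I f) x, V x⟫_ℝ = ⟪nabla V (gradField I f) x, U x⟫_ℝ := by
  have hA := (isSmoothField_gradField hf).mdiff x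
  have h1 := fieldDeriv_inner (U := U) hA (hV.mdiff x)
  have h2 := fieldDeriv_inner (U := V) hA (hU.mdiff x)
  simp_rw [inner_gradField] at h1 h2
  have h3 := fieldDeriv_mlieBracket (x := x) hU hV hf
  rw [← inner_gradField, ← nabla_sub_nabla (hU.mdiff x) (hV.mdiff x), inner_sub_right,
    inner_gradField, inner_gradField] at h3
  change _ = fieldDeriv I U (fun y ↦ fieldDeriv I V f y) x
    - fieldDeriv I V (fun y ↦ fieldDeriv I U f y) x at h3
  linarith

/-- The vector field `(Ric A♭)♯`. -/
def ricciField (A : Π y : M, TangentSpace I y) : Π y : M, TangentSpace I y :=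
  sharp I (fun y ↦ (ricci I y).flip (A y))

lemma inner_ricciField (v : TangentSpace I x) :
    ⟪ricciField A x, v⟫_ℝ = ricci I x v (A x) := inner_sharp _ _

lemma isSmoothField_ricciField (hA : IsSmoothField I A) : IsSmoothField I (ricciField A) := by
  refine isSmoothField_of_inner fun X hX ↦ ?_
  simp_rw [inner_ricciField]
  intro x
  obtain ⟨e, he⟩ := exists_orthonormalFrame (I := I) x
  have h : ContMDiffAt I 𝓘(ℝ) ∞ (fun y ↦ ∑ i, ⟪curvature I (e i) X A y, e i y⟫_ℝ) x := by
    refine contMDiffAt_finsetSum fun i _ ↦ ?_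
    have hei := he.smooth i
    have hc : IsSmoothField I (curvature I (e i) X A) :=
      ((hei.nabla (hX.nabla hA)).sub (hX.nabla (hei.nabla hA))).sub ((hei.bracket hX).nabla hA)
    exact hc.inner hei x
  refine h.congr_of_eventuallyEq ?_
  filter_upwards [he.orthonormal] with y hy using ricci_apply_frame hy he.smooth hX hA

/-- The endomorphism `u ↦ ∇²_{u, V} A`. -/
def hessField (A V : Π y : M, TangentSpace I y) (x : M) :
    TangentSpace I x →L[ℝ] TangentSpace I x :=
  leviCivita I (nabla V A) x - leviCivita I A x ∘L leviCivita I V x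

lemma tensorialAt_hessField (hA : IsSmoothField I A) :
    TensorialAt I E (fun V ↦ hessField A V x) x where
  smul {f V} hf hV := by
    simp only [hessField]
    rw [nabla_smul_left,
      (leviCivita I).isCovariantDerivativeOnUniv.leibniz (mdiff_nabla hV hA) hf,
      (leviCivita I).isCovariantDerivativeOnUniv.leibniz hV hf]
    ext u
    simp [nabla]
    module
  add {V V'} hV hV' := by
    simp only [hessField]
    rw [nabla_add_left,
      (leviCivita I).isCovariantDerivativeOnUniv.add (mdiff_nabla hV hA) (mdiff_nabla hV' hA),
      (leviCivita I).isCovariantDerivativeOnUniv.add hV hV']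
    ext u
    simp
    module

lemma sum_bilin_orthonormal {ι κ F : Type*} [Fintype ι] [Fintype κ] [NormedAddCommGroup F]
    [InnerProductSpace ℝ F] (b : OrthonormalBasis ι ℝ F) (c : OrthonormalBasis κ ℝ F)
    (L : F →L[ℝ] F →L[ℝ] F) : ∑ i, L (b i) (b i) = ∑ j, L (c j) (c j) := by
  have h (i) : L (b i) (b i) = ∑ j, ∑ k, (⟪c k, b i⟫_ℝ * ⟪b i, c j⟫_ℝ) • L (c j) (c k) := by
    conv_lhs => rw [← c.sum_repr' (b i)]
    simp only [map_sum, map_smul, sum_apply, smul_apply, Finset.smul_sum, smul_smul]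
    rw [Finset.sum_comm]
    simp only [real_inner_comm]
  simp_rw [h]
  rw [Finset.sum_comm]
  refine Finset.sum_congr rfl fun j _ ↦ ?_
  rw [Finset.sum_comm]
  simp_rw [← Finset.sum_smul, b.sum_inner_mul_inner]
  classical
  simp [orthonormal_iff_ite.1 c.orthonormal]

/-- The connection Laplacian of a vector field. -/
def boxField (A : Π y : M, TangentSpace I y) (x : M) : TangentSpace I x :=
  ∑ i, hessField A (onbField I x i) x (onb I x i)

lemma boxField_eq_sum (he : Orthonormal ℝ (fun i ↦ e i x)) (hes : ∀ i, IsSmoothField I (e i))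
    (hA : IsSmoothField I A) :
    boxField A x = ∑ i, (nabla (e i) (nabla (e i) A) x - nabla (nabla (e i) (e i)) A x) := by
  have h := sum_bilin_orthonormal (onb I x) (basisOfOrthonormal he)
    (TensorialAt.mkHom _ x (tensorialAt_hessField hA))
  have h1 (i) : TensorialAt.mkHom _ x (tensorialAt_hessField hA) (onb I x i)
      = hessField A (onbField I x i) x := rfl
  have h2 (i) : TensorialAt.mkHom _ x (tensorialAt_hessField hA) (e i x)
      = hessField A (e i) x := TensorialAt.mkHom_apply _ ((hes i).mdiff x)
  simp only [basisOfOrthonormal_apply, h1, h2] at h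
  exact h

lemma isSmoothField_boxField (hA : IsSmoothField I A) : IsSmoothField I (boxField A) := by
  refine IsSmoothField.congr_at fun x ↦ ?_
  obtain ⟨e, he⟩ := exists_orthonormalFrame (I := I) x
  refine ⟨fun y ↦ ∑ i, (nabla (e i) (nabla (e i) A) - nabla (nabla (e i) (e i)) A) y,
    IsSmoothField.sum fun i _ ↦ ?_, ?_⟩
  · have hei := he.smooth i
    exact (hei.nabla (hei.nabla hA)).sub ((hei.nabla hei).nabla hA)
  · filter_upwards [he.orthonormal] with y hy using boxField_eq_sum hy he.smooth hA

/-- Bochner's formula: `⟨□ ∇f, U⟩ = U(Δf) + Ric(U, ∇f)`. -/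
theorem inner_boxField_gradField (hf : ContMDiff I 𝓘(ℝ) ∞ f) (hU : IsSmoothField I U) :
    ⟪boxField (gradField I f) x, U x⟫_ℝ
      = fieldDeriv I U (divField I (gradField I f)) x + ricci I x (U x) (gradField I f x) := by
  obtain ⟨e, he⟩ := exists_orthonormalFrame (I := I) x
  have ho := he.orthonormal.self_of_nhds
  set A := gradField I f with hA'
  have hA : IsSmoothField I A := isSmoothField_gradField hf
  have hdiv := divField_nabla (x := x) hU hA
  have ht : traceNablaNabla A U x = ∑ i, ⟪leviCivita I A x (nabla (e i) U x), e i x⟫_ℝ :=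
    trace_eq_sum_inner' ho _
  have key (i) : ⟪nabla (e i) (nabla U A) x, e i x⟫_ℝ
      = ⟪nabla (e i) (nabla (e i) A) x - nabla (nabla (e i) (e i)) A x, U x⟫_ℝ
        + ⟪leviCivita I A x (nabla (e i) U x), e i x⟫_ℝ := by
    have hei := he.smooth i
    have h1 := fieldDeriv_inner (U := e i) ((hU.nabla hA).mdiff x) (hei.mdiff x)
    have h2 := fieldDeriv_inner (U := e i) ((hei.nabla hA).mdiff x) (hU.mdiff x)
    have h3 : ⟪nabla U A x, nabla (e i) (e i) x⟫_ℝ = ⟪nabla (nabla (e i) (e i)) A x, U x⟫_ℝ :=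
      inner_nabla_gradField hf hU (hei.nabla hei)
    have h4 : ⟪nabla (e i) A x, nabla (e i) U x⟫_ℝ = ⟪nabla (nabla (e i) U) A x, e i x⟫_ℝ :=
      inner_nabla_gradField hf hei (hei.nabla hU)
    have h5 : (fun y ↦ ⟪nabla U A y, e i y⟫_ℝ) = fun y ↦ ⟪nabla (e i) A y, U y⟫_ℝ :=
      funext fun y ↦ inner_nabla_gradField hf hU hei
    rw [h5, h3] at h1
    rw [h4] at h2
    rw [inner_sub_left]
    change _ = _ + ⟪nabla (nabla (e i) U) A x, e i x⟫_ℝ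
    linarith
  rw [divField_eq_sum ho, Finset.sum_congr rfl fun i _ ↦ key i, Finset.sum_add_distrib, ← ht,
    ← sum_inner, ← boxField_eq_sum ho he.smooth hA] at hdiv
  linarith

lemma boxField_sub_eq (he : IsOrthonormalFrameNear e x) (hA : IsSmoothField I A) :
    boxField A x - ricciField A x - gradField I (divField I A) x
      = ∑ k, (divField I (e k) • nabla (e k) A - divField I (nabla (e k) A) • e k
          + VectorField.mlieBracket I (e k) (nabla (e k) A)) x := by
  have ho := he.orthonormal.self_of_nhds
  have hbr (k) : VectorField.mlieBracket I (e k) (nabla (e k) A) x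
      = nabla (e k) (nabla (e k) A) x - nabla (nabla (e k) A) (e k) x :=
    (nabla_sub_nabla ((he.smooth k).mdiff x) (((he.smooth k).nabla hA).mdiff x)).symm
  have hbox : boxField A x = ∑ k, (divField I (e k) x • nabla (e k) A x
      + nabla (e k) (nabla (e k) A) x) := by
    rw [boxField_eq_sum ho he.smooth hA, Finset.sum_add_distrib, Finset.sum_sub_distrib, add_comm,
      sub_eq_add_neg]
    congr 1
    have h (i) : nabla (nabla (e i) (e i)) A x
        = ∑ k, ⟪e k x, nabla (e i) (e i) x⟫_ℝ • nabla (e k) A x := by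
      conv_lhs => rw [nabla, ← sum_inner_smul ho (nabla (e i) (e i) x)]
      simp [nabla]
    simp_rw [h, divField_eq_sum ho, Finset.sum_smul]
    rw [Finset.sum_comm, ← Finset.sum_neg_distrib]
    refine Finset.sum_congr rfl fun k _ ↦ ?_
    rw [← Finset.sum_neg_distrib]
    refine Finset.sum_congr rfl fun i _ ↦ ?_
    rw [inner_nabla_frame he, neg_smul]
  have hrest : ricciField A x + gradField I (divField I A) x
      = ∑ k, (divField I (nabla (e k) A) x • e k x + nabla (nabla (e k) A) (e k) x) := by
    refine ext_of_orthonormal ho fun j ↦ ?_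
    rw [inner_add_right, real_inner_comm, inner_ricciField, real_inner_comm, inner_gradField,
      inner_sum]
    have h1 := divField_nabla (x := x) (he.smooth j) hA
    have ht : traceNablaNabla (e j) A x
        = ∑ k, ⟪leviCivita I (e j) x (nabla (e k) A x), e k x⟫_ℝ := trace_eq_sum_inner' ho _
    have h2 (k) : ⟪e j x, divField I (nabla (e k) A) x • e k x
        + nabla (nabla (e k) A) (e k) x⟫_ℝ
        = (if j = k then divField I (nabla (e k) A) x else 0)
          - ⟪leviCivita I (e j) x (nabla (e k) A x), e k x⟫_ℝ := by
      rw [inner_add_right, inner_smul_right, orthonormal_iff_ite.1 ho j k]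
      have := inner_nabla_frame (U := nabla (e k) A) he j k
      change _ = _ - ⟪nabla (nabla (e k) A) (e j) x, e k x⟫_ℝ
      rw [this]
      simp
    simp_rw [h2, Finset.sum_sub_distrib]
    rw [← ht, traceNablaNabla_comm]
    simp
    linarith
  rw [sub_sub, hbox, hrest, ← Finset.sum_sub_distrib]
  refine Finset.sum_congr rfl fun k _ ↦ ?_
  simp only [Pi.add_apply, Pi.sub_apply, Pi.smul_apply', hbr]
  abel

/-- `div (□A - Ric A) = Δ (div A)`. -/
theorem divField_boxField_sub_ricciField (hA : IsSmoothField I A) :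
    divField I (boxField A - ricciField A) x
      = divField I (gradField I (divField I A)) x := by
  obtain ⟨e, he⟩ := exists_orthonormalFrame (I := I) x
  have hd := contMDiff_divField hA
  have h1 := (isSmoothField_boxField hA).sub (isSmoothField_ricciField hA)
  have h2 := isSmoothField_gradField hd
  rw [← sub_eq_zero, ← divField_sub (h1.mdiff x) (h2.mdiff x),
    divField_congr (by filter_upwards [he.eventually] with y hy using boxField_sub_eq hy hA),
    divField_sum]
  · exact Finset.sum_eq_zero fun k _ ↦
      divField_divField_wedge (he.smooth k) ((he.smooth k).nabla hA)
  · intro k _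
    have hB := (he.smooth k).nabla hA
    exact (((hB.smul (contMDiff_divField (he.smooth k))).sub
      ((he.smooth k).smul (contMDiff_divField hB))).add ((he.smooth k).bracket hB)).mdiff x

end

section
variable [T2Space M]

/-! ### From vector fields to `1`-forms -/

variable {U V W A B Z : Π y : M, TangentSpace I y} {f g : M → ℝ} {x : M}
  {α β : Π x : M, TangentSpace I x →L[ℝ] ℝ}

lemma flat_sharp (α : Π x : M, TangentSpace I x →L[ℝ] ℝ) : flat I x (sharp I α x) = α x :=
  (flat I x).apply_symm_apply _

lemma IsSmoothForm.sharp (hα : IsSmoothForm I α) : IsSmoothField I (sharp I α) := by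
  refine isSmoothField_of_inner fun X hX x ↦ ?_
  simp_rw [inner_sharp]
  have h : ContMDiffAt I (I.prod 𝓘(ℝ)) ∞
      (fun y ↦ TotalSpace.mk' ℝ (E := Bundle.Trivial M ℝ) y (α y (X y))) x := by
    apply ContMDiffAt.clm_bundle_apply (F₁ := E) (E₁ := fun x : M ↦ TangentSpace I x)
    · exact hα x
    · exact hX x
  rw [contMDiffAt_totalSpace] at h
  exact h.2

lemma IsSmoothField.flat (hA : IsSmoothField I A) :
    IsSmoothForm I (fun y ↦ flat I y (A y)) := by
  obtain ⟨g, hg, hg'⟩ := IsContMDiffRiemannianBundle.exists_contMDiff (IB := I) (n := ∞) (F := E)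
    (E := fun x : M ↦ TangentSpace I x)
  have h : (fun y ↦ RiemannianGeometry.flat I y (A y)) = fun y ↦ g y (A y) := by
    funext y; ext v; exact hg' y (A y) v
  rw [h]
  intro x
  apply ContMDiffAt.clm_bundle_apply (F₁ := E) (E₁ := fun x : M ↦ TangentSpace I x)
  · exact hg x
  · exact hA x

lemma isSmoothForm_of_sharp (h : IsSmoothField I (sharp I α)) : IsSmoothForm I α := by
  have := h.flat
  simpa only [flat_sharp] using this

lemma covForm_eq (hα : MDiffAt (T% (sharp I α)) x) (v : TangentSpace I x) :
    covForm I α x v = flat I x (leviCivita I (sharp I α) x v) := by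
  ext w
  rw [flat_apply, covForm]
  have h (j) : mvfderiv I (fun y ↦ α y (onbField I x j y)) x
      - α x ∘L leviCivita I (onbField I x j) x
      = flat I x (onb I x j) ∘L leviCivita I (sharp I α) x := by
    ext v
    have := mvfderiv_inner hα (mdifferentiableAt_onbField x j) v
    simp only [inner_sharp, extend_apply_self] at this
    simp [this, flat_apply, real_inner_comm]
  simp only [h, sum_apply, ContinuousLinearMap.smulRight_apply, ContinuousLinearMap.comp_apply,
    smul_apply, flat_apply, smul_eq_mul]
  rw [← (onb I x).sum_inner_mul_inner]
  simp only [real_inner_comm]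

lemma sharp_covForm (hα : IsSmoothForm I α) (V : Π y : M, TangentSpace I y) :
    sharp I (fun y ↦ covForm I α y (V y)) = nabla V (sharp I α) := by
  funext y
  rw [sharp, covForm_eq (hα.sharp.mdiff y), ContinuousLinearEquiv.symm_apply_apply, nabla]

lemma boxForm_eq (hα : IsSmoothForm I α) :
    boxForm I α x = flat I x (boxField (sharp I α) x) := by
  rw [boxForm, boxField, map_sum]
  refine Finset.sum_congr rfl fun i _ ↦ ?_
  rw [covForm₂, covForm_eq, covForm_eq (hα.sharp.mdiff x), sharp_covForm hα, hessField, ← map_sub]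
  · rfl
  · rw [sharp_covForm hα]
    exact mdiff_nabla (mdifferentiableAt_onbField x i) hα.sharp

lemma divForm_eq (hα : MDiffAt (T% (sharp I α)) x) : divForm I α x = divField I (sharp I α) x := by
  rw [divForm, divField]
  congr 2
  ext v
  simp [covForm_eq hα]

lemma laplacian_eq (hf : ContMDiff I 𝓘(ℝ) ∞ f) :
    laplacian I f x = divField I (gradField I f) x :=
  divForm_eq ((isSmoothField_gradField hf).mdiff x)

lemma isSmoothForm_mvfderiv (hf : ContMDiff I 𝓘(ℝ) ∞ f) : IsSmoothForm I (mvfderiv I f) :=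
  isSmoothForm_of_sharp (isSmoothField_gradField hf)

lemma codiff_eq (hα : IsSmoothForm I α) : codiff I α = -divField I (sharp I α) :=
  funext fun y ↦ congrArg Neg.neg (divForm_eq (hα.sharp.mdiff y))

lemma ricciZForm_apply (a : TangentSpace I x →L[ℝ] ℝ) (v : TangentSpace I x) :
    ricciZForm I Z x a v = ricci I x v ((flat I x).symm a)
      - ⟪leviCivita I Z x v, (flat I x).symm a⟫_ℝ := by
  simp [ricciZForm, ricciZ, flat_apply]

lemma formAdjoint_ricciZForm (hα : IsSmoothForm I α) :
    formAdjoint I x (ricciZForm I Z x) (α x)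
      = flat I x (ricciField (sharp I α) x - nabla (sharp I α) Z x) := by
  ext v
  obtain ⟨V, hV, rfl, -⟩ := exists_smoothField_eventuallyEq_extend v
  simp only [formAdjoint, ContinuousLinearMap.comp_apply, ContinuousLinearEquiv.coe_coe, flat_apply]
  rw [ContinuousLinearMap.adjoint_inner_left, real_inner_comm]
  simp only [ContinuousLinearMap.comp_apply, ContinuousLinearEquiv.coe_coe]
  rw [inner_flat_symm, ricciZForm_apply, ContinuousLinearEquiv.symm_apply_apply, inner_sub_left,
    inner_ricciField]
  have := ricci_symm (x := x) hα.sharp hV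
  exact congrArg (· - _) this

/-- The vector field dual to `(□ - Ric_Z^* + ∇_Z^*) α`. -/
lemma sharp_adjointOperator (hα : IsSmoothForm I α) :
    sharp I (fun y ↦ boxForm I α y - formAdjoint I y (ricciZForm I Z y) (α y)
        + covAlongAdjoint I Z α y)
      = boxField (sharp I α) - ricciField (sharp I α) + nabla (sharp I α) Z
        - nabla Z (sharp I α) - divField I Z • sharp I α := by
  funext y
  rw [sharp, boxForm_eq hα, formAdjoint_ricciZForm hα, covAlongAdjoint, covAlong,
    covForm_eq (hα.sharp.mdiff y)]
  simp only [map_add, map_sub, map_neg, map_smul, ContinuousLinearEquiv.symm_apply_apply,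
    Pi.add_apply, Pi.sub_apply, Pi.smul_apply', nabla]
  change _ - _ + (_ - _ • sharp I α y) = _
  abel

theorem mvfderiv_laplacian_add_fieldDeriv (hZ : IsSmoothField I Z) (hf : ContMDiff I 𝓘(ℝ) ∞ f) :
    ContMDiff I 𝓘(ℝ) ∞ (fun y ↦ laplacian I f y + fieldDeriv I Z f y) ∧
    ∀ x : M, mvfderiv I (fun y ↦ laplacian I f y + fieldDeriv I Z f y) x
      = boxForm I (mvfderiv I f) x - ricciZForm I Z x (mvfderiv I f x)
        + covAlong I Z (mvfderiv I f) x := by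
  have hA := isSmoothField_gradField hf
  have hd := contMDiff_divField hA
  have hZf := contMDiff_fieldDeriv hZ hf
  have hl : laplacian I f = divField I (gradField I f) := funext fun y ↦ laplacian_eq hf
  have hα := isSmoothForm_mvfderiv hf
  rw [hl]
  refine ⟨hd.add hZf, fun x ↦ ?_⟩
  ext v
  obtain ⟨V, hV, rfl, -⟩ := exists_smoothField_eventuallyEq_extend v
  have h1 := inner_boxField_gradField (x := x) hf hV
  have h2 := fieldDeriv_inner (U := V) (hA.mdiff x) (hZ.mdiff x)
  simp_rw [inner_gradField] at h2
  have h3 := inner_nabla_gradField (x := x) hf hV hZ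
  rw [mvfderiv_fun_add (ContMDiff.mdiff hd x) (ContMDiff.mdiff hZf x)]
  simp only [add_apply, sub_apply]
  rw [boxForm_eq hα, ricciZForm_apply, covAlong, covForm_eq (hA.mdiff x), flat_apply, flat_apply]
  change fieldDeriv I V _ x + fieldDeriv I V (fun y ↦ fieldDeriv I Z f y) x
    = ⟪boxField (gradField I f) x, _⟫_ℝ - (ricci I x (V x) (gradField I f x)
      - ⟪nabla V Z x, gradField I f x⟫_ℝ) + ⟪nabla Z (gradField I f) x, V x⟫_ℝ
  rw [h1, h2, h3, real_inner_comm (gradField I f x), inner_gradField (U := nabla V Z)]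
  ring

theorem isSmoothForm_adjointOperator (hZ : IsSmoothField I Z) (hα : IsSmoothForm I α) :
    IsSmoothForm I (fun y ↦ boxForm I α y - formAdjoint I y (ricciZForm I Z y) (α y)
        + covAlongAdjoint I Z α y) := by
  apply isSmoothForm_of_sharp
  rw [sharp_adjointOperator hα]
  have hA := hα.sharp
  exact ((((isSmoothField_boxField hA).sub (isSmoothField_ricciField hA)).add
    (hA.nabla hZ)).sub (hZ.nabla hA)).sub (hA.smul (contMDiff_divField hZ))

theorem laplacian_codiff_add_fieldDerivAdjoint_codiff (hZ : IsSmoothField I Z)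
    (hα : IsSmoothForm I α) (x : M) :
    laplacian I (codiff I α) x + fieldDerivAdjoint I Z (codiff I α) x
      = codiff I (fun y ↦ boxForm I α y - formAdjoint I y (ricciZForm I Z y) (α y)
        + covAlongAdjoint I Z α y) x := by
  have hA := hα.sharp
  have hd := contMDiff_divField hA
  have hdZ := contMDiff_divField hZ
  have h1 := (isSmoothField_boxField hA).sub (isSmoothField_ricciField hA)
  have h2 := hA.nabla hZ
  have h3 := hZ.nabla hA
  have h4 := hA.smul hdZ
  have hg := isSmoothField_gradField hd
  have hdn : ContMDiff I 𝓘(ℝ) ∞ (-divField I (sharp I α)) := hd.neg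
  have hneg : gradField I (-divField I (sharp I α)) = -gradField I (divField I (sharp I α)) := by
    funext y
    simp only [sharp, Pi.neg_apply]
    rw [← map_neg]
    congr 1
    exact mvfderiv_neg
  rw [codiff_eq (isSmoothForm_adjointOperator hZ hα), codiff_eq hα, sharp_adjointOperator hα,
    laplacian_eq hdn, hneg, divField_neg (hg.mdiff x), fieldDerivAdjoint]
  simp only [Pi.neg_apply]
  rw [divField_sub (((h1.add h2).sub h3).mdiff x) (h4.mdiff x),
    divField_sub ((h1.add h2).mdiff x) (h3.mdiff x), divField_add (h1.mdiff x) (h2.mdiff x),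
    divField_boxField_sub_ricciField hA, divField_nabla hA hZ, divField_nabla hZ hA,
    divField_smul (ContMDiff.mdiff hdZ x) (hA.mdiff x), traceNablaNabla_comm (A := Z),
    ricci_symm hA hZ]
  have : fieldDeriv I Z (-divField I (sharp I α)) x = -fieldDeriv I Z (divField I (sharp I α)) x := by
    simp only [fieldDeriv]
    rw [mvfderiv_neg]; rfl
  rw [this]
  ring

theorem formInner_covAlong_sub (hZ : IsSmoothField I Z) (hα : IsSmoothForm I α)
    (hβ : IsSmoothForm I β) (x : M) :
    formInner I x (covAlong I Z α x) (β x) - formInner I x (α x) (covAlongAdjoint I Z β x)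
      = divField I (fun y ↦ formInner I y (α y) (β y) • Z y) x := by
  have hA := hα.sharp
  have hB := hβ.sharp
  have h := divField_smul (ContMDiff.mdiff (hA.inner hB) x) (hZ.mdiff x)
  rw [fieldDeriv_inner (hA.mdiff x) (hB.mdiff x)] at h
  refine Eq.trans ?_ h.symm
  simp only [formInner, covAlongAdjoint, covAlong]
  rw [covForm_eq (hA.mdiff x), covForm_eq (hB.mdiff x)]
  simp only [map_sub, map_neg, map_smul, ContinuousLinearEquiv.symm_apply_apply, inner_sub_right,
    inner_neg_right, inner_smul_right]
  change ⟪nabla Z (sharp I α) x, sharp I β x⟫_ℝ - (-⟪sharp I α x, nabla Z (sharp I β) x⟫_ℝ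
    - _ * ⟪sharp I α x, sharp I β x⟫_ℝ) = _
  ring

end

end RiemannianGeometry

end

theorem mainTheorem10 (n : ℕ)
    {M : Type*} [TopologicalSpace M] [T2Space M] [ChartedSpace (EuclideanSpace ℝ (Fin n)) M]
    [IsManifold (𝓡 n) ∞ M]
    [RiemannianBundle (fun x : M ↦ TangentSpace (𝓡 n) x)]
    [IsContMDiffRiemannianBundle (𝓡 n) ∞ (EuclideanSpace ℝ (Fin n))
      (fun x : M ↦ TangentSpace (𝓡 n) x)]
    (Z : Π x : M, TangentSpace (𝓡 n) x) (hZ : RiemannianGeometry.IsSmoothField (𝓡 n) Z) :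
    -- `d (Δ + Z) = (□ - Ric_Z + ∇_Z) d` on smooth functions
    (∀ f : M → ℝ, ContMDiff (𝓡 n) 𝓘(ℝ) ∞ f →
      ContMDiff (𝓡 n) 𝓘(ℝ) ∞ (fun y ↦ RiemannianGeometry.laplacian (𝓡 n) f y
        + RiemannianGeometry.fieldDeriv (𝓡 n) Z f y) ∧
      ∀ x : M,
        mvfderiv (𝓡 n) (fun y ↦ RiemannianGeometry.laplacian (𝓡 n) f y
          + RiemannianGeometry.fieldDeriv (𝓡 n) Z f y) x
        = RiemannianGeometry.boxForm (𝓡 n) (mvfderiv (𝓡 n) f) x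
          - RiemannianGeometry.ricciZForm (𝓡 n) Z x (mvfderiv (𝓡 n) f x)
          + RiemannianGeometry.covAlong (𝓡 n) Z (mvfderiv (𝓡 n) f) x) ∧
    -- `(Δ + Z^*) d^* = d^* (□ - Ric_Z^* + ∇_Z^*)` on smooth `1`-forms
    (∀ α : Π x : M, TangentSpace (𝓡 n) x →L[ℝ] ℝ, RiemannianGeometry.IsSmoothForm (𝓡 n) α →
      ContMDiff (𝓡 n) 𝓘(ℝ) ∞ (RiemannianGeometry.codiff (𝓡 n) α) ∧
      RiemannianGeometry.IsSmoothForm (𝓡 n) (fun y ↦ RiemannianGeometry.boxForm (𝓡 n) α y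
        - RiemannianGeometry.formAdjoint (𝓡 n) y (RiemannianGeometry.ricciZForm (𝓡 n) Z y) (α y)
        + RiemannianGeometry.covAlongAdjoint (𝓡 n) Z α y) ∧
      ∀ x : M,
        RiemannianGeometry.laplacian (𝓡 n) (RiemannianGeometry.codiff (𝓡 n) α) x
          + RiemannianGeometry.fieldDerivAdjoint (𝓡 n) Z (RiemannianGeometry.codiff (𝓡 n) α) x
        = RiemannianGeometry.codiff (𝓡 n) (fun y ↦ RiemannianGeometry.boxForm (𝓡 n) α y
          - RiemannianGeometry.formAdjoint (𝓡 n) y (RiemannianGeometry.ricciZForm (𝓡 n) Z y) (α y)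
          + RiemannianGeometry.covAlongAdjoint (𝓡 n) Z α y) x) ∧
    -- `∇_Z^*` is the formal adjoint of `∇_Z`: the difference of the pairings is a divergence
    (∀ α β : Π x : M, TangentSpace (𝓡 n) x →L[ℝ] ℝ,
      RiemannianGeometry.IsSmoothForm (𝓡 n) α → RiemannianGeometry.IsSmoothForm (𝓡 n) β →
      ∀ x : M,
        RiemannianGeometry.formInner (𝓡 n) x (RiemannianGeometry.covAlong (𝓡 n) Z α x) (β x)
          - RiemannianGeometry.formInner (𝓡 n) x (α x)
              (RiemannianGeometry.covAlongAdjoint (𝓡 n) Z β x)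
        = RiemannianGeometry.divField (𝓡 n)
            (fun y ↦ RiemannianGeometry.formInner (𝓡 n) y (α y) (β y) • Z y) x) := by
  refine ⟨fun f hf ↦ RiemannianGeometry.mvfderiv_laplacian_add_fieldDeriv hZ hf,
    fun α hα ↦ ⟨?_, RiemannianGeometry.isSmoothForm_adjointOperator hZ hα,
      RiemannianGeometry.laplacian_codiff_add_fieldDerivAdjoint_codiff hZ hα⟩,
    fun α β hα hβ ↦ RiemannianGeometry.formInner_covAlong_sub hZ hα hβ⟩
  rw [RiemannianGeometry.codiff_eq hα]
  exact (RiemannianGeometry.contMDiff_divField hα.sharp).neg
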